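/- There are an absolute constant $C$ and one random access machine program with the following property. Let $m,n\ge 1$ be integers, let $A\in([0,1]\cap\mathbb Q)^{m\times n}$ and $x\in([0,1]\cap\mathbb Q)^n$, and assume that $\sum_{i=1}^n x_i\in\mathbb Z$. Started on the input $(m,n,A,x)$, the program halts after at most $C\,mn\log n$ steps and outputs a vector $y\in\{0,1\}^n$ such that (i) $\sum_{i=1}^n y_i=\sum_{i=1}^n x_i$, and (ii) $(Ay)_r\le C\,\max\{1,(Ax)_r\}\,\dfrac{\log m}{\log\log m}$ for all $r\in\{1,\dots,m\}$. Here, in the degenerate cases, $\log n$ is read as $\log 2$ if $n=1$, and $\log m/\log\log m$ is read as $\log 3/\log\log 3$ if $m\le 2$. The machine is the (unit-cost) random access machine: its registers and memory cells hold integers; each addition, subtraction, multiplication, load or store with indirect addressing, jump, or jump conditional on the sign of a register is one step; each rational number of the input is given as its numerator and denominator, in lowest terms, in two memory cells. -/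

import Mathlib

namespace RAM

/-- Instructions of a random access machine. Operands `d`, `a`, `b` name registers; registers and
memory cells hold integers, and an instruction costs one time unit. The only arithmetic is
addition, subtraction and multiplication: there is no division, and there are no powers. -/
inductive Instr where
  /-- `R d := z`, for a constant `z` fixed in the program. -/
  | const (d : ℕ) (z : ℤ)
  /-- `R d := R a + R b` -/
  | add (d a b : ℕ)
  /-- `R d := R a - R b` -/
  | sub (d a b : ℕ)
  /-- `R d := R a * R b` -/
  | mul (d a b : ℕ)
  /-- `R d := M (R a)`, a read with indirect addressing. -/
  | load (d a : ℕ)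
  /-- `M (R a) := R b`, a write with indirect addressing. -/
  | store (a b : ℕ)
  /-- Continue with instruction number `l`. -/
  | jump (l : ℕ)
  /-- Continue with instruction number `l` if `R a > 0`, else with the next instruction. -/
  | jumpPos (a l : ℕ)

/-- A program is a finite list of instructions, numbered from `0`. -/
abbrev Program := List Instr

/-- A configuration: the program counter, the registers and the memory. -/
structure Config where
  pc : ℕ
  reg : ℕ → ℤ
  mem : ℕ → ℤ

/-- The effect of one instruction. A negative address is read as the address `0`. -/
def Instr.exec (c : Config) : Instr → Config
  | .const d z => { c with pc := c.pc + 1, reg := Function.update c.reg d z }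
  | .add d a b => { c with pc := c.pc + 1, reg := Function.update c.reg d (c.reg a + c.reg b) }
  | .sub d a b => { c with pc := c.pc + 1, reg := Function.update c.reg d (c.reg a - c.reg b) }
  | .mul d a b => { c with pc := c.pc + 1, reg := Function.update c.reg d (c.reg a * c.reg b) }
  | .load d a =>
      { c with pc := c.pc + 1, reg := Function.update c.reg d (c.mem (c.reg a).toNat) }
  | .store a b =>
      { c with pc := c.pc + 1, mem := Function.update c.mem (c.reg a).toNat (c.reg b) }
  | .jump l => { c with pc := l }
  | .jumpPos a l => { c with pc := if 0 < c.reg a then l else c.pc + 1 }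

/-- The machine has halted when the program counter points outside of the program. -/
def Program.Halted (P : Program) (c : Config) : Prop := P.length ≤ c.pc

/-- One step of the machine; a halted machine does not change any more. -/
def Program.step (P : Program) (c : Config) : Config :=
  match P[c.pc]? with
  | some i => i.exec c
  | none => c

/-- The start on memory contents `M`: instruction `0` is next and all registers are `0`. -/
def start (M : ℕ → ℤ) : Config := { pc := 0, reg := fun _ => 0, mem := M }

/-- Started on memory contents `M`, the program halts after at most `T` steps, with memory
contents `M'`. -/
def Program.HaltsWithin (P : Program) (M : ℕ → ℤ) (T : ℝ) (M' : ℕ → ℤ) : Prop :=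
  ∃ t : ℕ, (t : ℝ) ≤ T ∧ P.Halted (P.step^[t] (start M)) ∧ (P.step^[t] (start M)).mem = M'

/-- A rational number is given to the machine as its numerator and its (positive) denominator,
in lowest terms. -/
def ratWords (q : ℚ) : List ℤ := [q.num, (q.den : ℤ)]

/-- The input words for an `m × n` matrix `A` and a vector `x`: the dimensions `m` and `n`, the
entries of `A` row by row, and the entries of `x`. -/
def inputWords {m n : ℕ} (A : Matrix (Fin m) (Fin n) ℚ) (x : Fin n → ℚ) : List ℤ :=
  [(m : ℤ), (n : ℤ)]
    ++ (List.finRange m).flatMap (fun r => (List.finRange n).flatMap fun i => ratWords (A r i))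
    ++ (List.finRange n).flatMap (fun i => ratWords (x i))

/-- The initial memory: the input words in the cells `0, 1, 2, …`, and `0` in all others. -/
def inputMemory {m n : ℕ} (A : Matrix (Fin m) (Fin n) ℚ) (x : Fin n → ℚ) : ℕ → ℤ :=
  fun k => (inputWords A x).getD k 0

end RAM

/-!
The algorithm is pipage rounding, with a pessimistic estimator as potential, in exact arithmetic.

Put `δ = ⌈log₂ m⌉` (at least `1`). Attach to row `r` the potential
`∏ k, (1 + δ a r k z k) / ∏ k, (1 + δ a r k x k)`, where `z` is the current vector; in the beginning
`z = x`, and the sum of the potentials over all rows is `m`. The columns are read one after the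
other, and at any time at most one column that has been read, the active one, is not yet fixed to
`0` or `1`. When column `i` is read, mass is shifted between it and the active column `j` until one
of the two is integral; this keeps `∑ z k` and can be done in two directions. As a function of the
shifted amount every potential is concave, so one of the directions does not increase the sum
(`PipageRounding.potential_next_le`). Moreover the difference of the two outcomes is a positive
multiple of `± ∑ r, w r * (a r j - a r i)` with weights `w r` that are known from the columns read
so far, so that the choice takes `O(m)` operations. The factors of the columns not yet read cancel
in the quotient, so the future never has to be computed. In the end the last active column is
integral because the total mass is, and every row satisfies
`∏ k, (1 + δ a r k y k) ≤ m ∏ k, (1 + δ a r k x k)` (`PipageRounding.Invariant.prod_output_le`).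

By Bernoulli's inequality `(1 + δ) ^ a ≤ 1 + δ a` for `0 ≤ a ≤ 1`, and by `1 + t ≤ exp t`, this
gives `(A y) r * log (1 + δ) ≤ log m + δ (A x) r` (`PipageRounding.sum_mul_log_le`), and `δ` being of
the order of `log m` turns this into the bound with the factor `log m / log log m`
(`PipageRounding.le_of_mul_log_le`).

The machine has no division, but a fraction can be kept as a pair of integers, and an operation
costs one step however large they are. The program keeps the weight of each row and the running sum
in this form and runs in time `O(m n)` (`PipageRounding.main_hoare`); the factor `log n` of the time
bound is not needed. It is written as a structured program (`RAM.Cmd`), compiled to the machine by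
`RAM.Cmd.compile`, and verified in a Hoare logic that counts steps.
-/

namespace RAM

/-! ### Structured programs and a timed Hoare logic -/

/-- The part of a configuration that a structured program acts on: everything but the program
counter. -/
structure Store where
  reg : ℕ → ℤ
  mem : ℕ → ℤ

/-- The configuration with program counter `pc` and contents `s`. -/
def Store.at (s : Store) (pc : ℕ) : Config := ⟨pc, s.reg, s.mem⟩

/-- The instructions that are not jumps. -/
def Instr.isStraight : Instr → Bool
  | .jump _ => false
  | .jumpPos _ _ => false
  | _ => true

/-- The action of an instruction on registers and memory. -/
def Instr.effect (s : Store) (i : Instr) : Store :=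
  ⟨(i.exec (s.at 0)).reg, (i.exec (s.at 0)).mem⟩

/-- Structured programs: straight-line code, sequences, a conditional and a loop, both governed by
the sign of the register `a`. -/
inductive Cmd where
  | block (l : List Instr)
  | seq (c d : Cmd)
  /-- If `R a > 0` then `c` else `d`. -/
  | ite (a : ℕ) (c d : Cmd)
  /-- While `R a > 0` do `c`. -/
  | loop (a : ℕ) (c : Cmd)

/-- The number of instructions that a structured program is compiled to. -/
def Cmd.size : Cmd → ℕ
  | .block l => l.length
  | .seq c d => c.size + d.size
  | .ite _ c d => d.size + c.size + 2
  | .loop _ c => c.size + 3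

/-- The machine code of a structured program, placed so that its first instruction has the
number `b`. -/
def Cmd.compile : Cmd → ℕ → Program
  | .block l, _ => l
  | .seq c d, b => c.compile b ++ d.compile (b + c.size)
  | .ite a c d, b =>
      [.jumpPos a (b + 1 + d.size + 1)] ++ (d.compile (b + 1) ++
        ([.jump (b + 1 + d.size + 1 + c.size)] ++ c.compile (b + 1 + d.size + 1)))
  | .loop a c, b =>
      [.jumpPos a (b + 1 + 1), .jump (b + c.size + 3)] ++ (c.compile (b + 2) ++ [.jump b])

theorem Cmd.length_compile (c : Cmd) (b : ℕ) : (c.compile b).length = c.size := by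
  induction c generalizing b with
  | block l => rfl
  | seq c d hc hd => simp [compile, size, hc, hd]
  | ite a c d hc hd => simp [compile, size, hc, hd]; omega
  | loop a c hc => simp [compile, size, hc]

/-- The instructions of `P` from number `b` on begin with `l`. -/
def Program.CodeAt (P : Program) (b : ℕ) (l : List Instr) : Prop :=
  ∀ k i, l[k]? = some i → P[b + k]? = some i

theorem Program.CodeAt.left {P : Program} {b : ℕ} {l l' : List Instr}
    (h : P.CodeAt b (l ++ l')) : P.CodeAt b l := by
  intro k i hk
  obtain ⟨hlt, -⟩ := List.getElem?_eq_some_iff.1 hk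
  exact h k i (by rwa [List.getElem?_append_left hlt])

theorem Program.CodeAt.right {P : Program} {b : ℕ} {l l' : List Instr}
    (h : P.CodeAt b (l ++ l')) : P.CodeAt (b + l.length) l' := by
  intro k i hk
  have := h (l.length + k) i (by simpa [List.getElem?_append_right] using hk)
  rwa [add_assoc]

theorem Program.step_of_getElem? {P : Program} {c : Config} {i : Instr}
    (h : P[c.pc]? = some i) : P.step c = i.exec c := by
  simp [Program.step, h]

/-- Wherever the machine code of `c` is placed in a program, it turns the contents `s` into `s'` in
exactly `t` steps and then continues behind its last instruction. -/
def Cmd.Runs (c : Cmd) (s : Store) (t : ℕ) (s' : Store) : Prop :=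
  ∀ (P : Program) (b : ℕ), P.CodeAt b (c.compile b) →
    P.step^[t] (s.at b) = s'.at (b + c.size)

theorem Cmd.Runs.block {l : List Instr} (hl : l.all Instr.isStraight = true) (s : Store) :
    (Cmd.block l).Runs s l.length (l.foldl Instr.effect s) := by
  intro P b h
  change P.CodeAt b l at h
  change _ = Store.at _ (b + l.length)
  induction l generalizing s b with
  | nil => rfl
  | cons i l ih =>
    have hi : P[b]? = some i := h 0 i rfl
    simp only [List.all_cons, Bool.and_eq_true] at hl
    have hstep : P.step (s.at b) = (i.effect s).at (b + 1) := by
      rw [Program.step_of_getElem? (c := s.at b) hi]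
      cases i <;> first | rfl | exact absurd hl.1 (by simp [Instr.isStraight])
    have htail : P.CodeAt (b + 1) l := Program.CodeAt.right (l := [i]) h
    rw [List.length_cons, Function.iterate_succ_apply, hstep, ih hl.2 _ _ htail,
      add_right_comm, add_assoc]
    rfl

theorem Cmd.Runs.seq {c d : Cmd} {s s' s'' : Store} {t t' : ℕ} (hc : c.Runs s t s')
    (hd : d.Runs s' t' s'') : (Cmd.seq c d).Runs s (t + t') s'' := by
  intro P b h
  rw [Cmd.compile] at h
  have h2 := h.right
  rw [Cmd.length_compile] at h2
  rw [add_comm t, Function.iterate_add_apply, hc P b h.left, hd P _ h2, Cmd.size, add_assoc]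

theorem Cmd.Runs.ite_pos {a : ℕ} {c d : Cmd} {s s' : Store} {t : ℕ} (ha : 0 < s.reg a)
    (hc : c.Runs s t s') : (Cmd.ite a c d).Runs s (t + 1) s' := by
  intro P b h
  rw [Cmd.compile] at h
  have h0 := h.left 0 _ rfl
  have h3 := h.right.right.right
  simp only [Cmd.length_compile, List.length_singleton] at h3
  rw [Function.iterate_succ_apply, Program.step_of_getElem? (c := s.at b) h0]
  have : (Instr.jumpPos a (b + 1 + d.size + 1)).exec (s.at b) = s.at (b + 1 + d.size + 1) := by
    simp [Instr.exec, Store.at, ha]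
  rw [this, hc P _ h3, Cmd.size]
  congr 1
  omega

theorem Cmd.Runs.ite_neg {a : ℕ} {c d : Cmd} {s s' : Store} {t : ℕ} (ha : ¬ 0 < s.reg a)
    (hd : d.Runs s t s') : (Cmd.ite a c d).Runs s (t + 2) s' := by
  intro P b h
  rw [Cmd.compile] at h
  have h0 := h.left 0 _ rfl
  have h1 := h.right.left
  have h2 := h.right.right.left 0 _ rfl
  simp only [Cmd.length_compile, List.length_singleton] at h1 h2
  have e0 : P.step (s.at b) = s.at (b + 1) := by
    rw [Program.step_of_getElem? (c := s.at b) h0]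
    simp [Instr.exec, Store.at, ha]
  have e2 : P.step (s'.at (b + 1 + d.size)) = s'.at (b + 1 + d.size + 1 + c.size) := by
    rw [Program.step_of_getElem? (c := s'.at (b + 1 + d.size)) h2]
    rfl
  rw [Function.iterate_succ_apply, e0, Function.iterate_succ_apply', hd P _ h1, e2, Cmd.size]
  congr 1
  omega

theorem Cmd.Runs.loop_exit {a : ℕ} {c : Cmd} {s : Store} (ha : ¬ 0 < s.reg a) :
    (Cmd.loop a c).Runs s 2 s := by
  intro P b h
  rw [Cmd.compile] at h
  have h0 := h.left 0 _ rfl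
  have h1 := h.left 1 _ rfl
  have e0 : P.step (s.at b) = s.at (b + 1) := by
    rw [Program.step_of_getElem? (c := s.at b) h0]
    simp [Instr.exec, Store.at, ha]
  rw [Function.iterate_succ_apply, e0, Function.iterate_one,
    Program.step_of_getElem? (c := s.at (b + 1)) h1]
  rfl

theorem Cmd.Runs.loop_step {a : ℕ} {c : Cmd} {s s' s'' : Store} {t t' : ℕ} (ha : 0 < s.reg a)
    (hc : c.Runs s t s') (h' : (Cmd.loop a c).Runs s' t' s'') :
    (Cmd.loop a c).Runs s (t + 2 + t') s'' := by
  intro P b h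
  have hrest := h' P b h
  rw [Cmd.compile] at h
  have h0 := h.left 0 _ rfl
  have h1 := h.right.left
  have h2 := h.right.right 0 _ rfl
  simp only [Cmd.length_compile, List.length_cons, List.length_nil] at h1 h2
  have e0 : P.step (s.at b) = s.at (b + 2) := by
    rw [Program.step_of_getElem? (c := s.at b) h0]
    simp [Instr.exec, Store.at, ha]
  have e2 : P.step (s'.at (b + 2 + c.size)) = s'.at b := by
    rw [Program.step_of_getElem? (c := s'.at (b + 2 + c.size)) h2]
    rfl
  rw [add_comm, Function.iterate_add_apply, Function.iterate_succ_apply, e0,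
    Function.iterate_succ_apply', hc P _ h1, e2, hrest]

/-- Total correctness with a time bound: from contents that satisfy `p`, the code of `c` arrives in
at most `T` steps at contents that satisfy `q`. -/
def Hoare (p : Store → Prop) (c : Cmd) (T : ℕ) (q : Store → Prop) : Prop :=
  ∀ s, p s → ∃ t ≤ T, ∃ s', c.Runs s t s' ∧ q s'

/-- Programs without loops and without jumps in their blocks. -/
def Cmd.isLoopFree : Cmd → Bool
  | .block l => l.all Instr.isStraight
  | .seq c d => c.isLoopFree && d.isLoopFree
  | .ite _ c d => c.isLoopFree && d.isLoopFree
  | .loop _ _ => false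

/-- The function computed by a loop-free program (loops are skipped). -/
def Cmd.eval : Cmd → Store → Store
  | .block l, s => l.foldl Instr.effect s
  | .seq c d, s => d.eval (c.eval s)
  | .ite a c d, s => if 0 < s.reg a then c.eval s else d.eval s
  | .loop _ _, s => s

theorem Cmd.Runs.eval {c : Cmd} (hc : c.isLoopFree = true) (s : Store) :
    ∃ t ≤ c.size, c.Runs s t (c.eval s) := by
  induction c generalizing s with
  | block l => exact ⟨_, le_rfl, .block hc s⟩
  | seq c d ihc ihd =>
    simp only [Cmd.isLoopFree, Bool.and_eq_true] at hc
    obtain ⟨t, ht, h⟩ := ihc hc.1 s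
    obtain ⟨t', ht', h'⟩ := ihd hc.2 (c.eval s)
    exact ⟨t + t', add_le_add ht ht', h.seq h'⟩
  | ite a c d ihc ihd =>
    simp only [Cmd.isLoopFree, Bool.and_eq_true] at hc
    simp only [Cmd.eval, Cmd.size]
    split_ifs with ha
    · obtain ⟨t, ht, h⟩ := ihc hc.1 s
      exact ⟨t + 1, by omega, h.ite_pos ha⟩
    · obtain ⟨t, ht, h⟩ := ihd hc.2 s
      exact ⟨t + 2, by omega, h.ite_neg ha⟩
  | loop a c => simp [Cmd.isLoopFree] at hc

/-- Whether the instruction writes to register `k`. -/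
def Instr.writes (k : ℕ) : Instr → Bool
  | .const d _ => d == k
  | .add d _ _ => d == k
  | .sub d _ _ => d == k
  | .mul d _ _ => d == k
  | .load d _ => d == k
  | _ => false

/-- Whether some instruction of the program writes to register `k`. -/
def Cmd.writes (k : ℕ) : Cmd → Bool
  | .block l => l.any (Instr.writes k)
  | .seq c d => c.writes k || d.writes k
  | .ite _ c d => c.writes k || d.writes k
  | .loop _ c => c.writes k

theorem Cmd.eval_reg {c : Cmd} {k : ℕ} (h : c.writes k = false) (s : Store) :
    (c.eval s).reg k = s.reg k := by
  induction c generalizing s with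
  | block l =>
    simp only [Cmd.writes, List.any_eq_false] at h
    induction l generalizing s with
    | nil => rfl
    | cons i l ih =>
      have hi := h i (by simp)
      have := ih (i.effect s) fun j hj => h j (by simp [hj])
      refine this.trans ?_
      cases i <;> simp [Instr.writes, Instr.effect, Instr.exec, Store.at] at hi ⊢ <;>
        exact Function.update_of_ne (Ne.symm hi) _ _
  | seq c d ihc ihd =>
    simp only [Cmd.writes, Bool.or_eq_false_iff] at h
    exact (ihd h.2 _).trans (ihc h.1 _)
  | ite a c d ihc ihd =>
    simp only [Cmd.writes, Bool.or_eq_false_iff] at h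
    simp only [Cmd.eval]
    split_ifs
    exacts [ihc h.1 _, ihd h.2 _]
  | loop a c => rfl

/-- A loop-free program executes each of its instructions at most once. -/
theorem Hoare.eval {p q : Store → Prop} {c : Cmd} (hc : c.isLoopFree = true)
    (h : ∀ s, p s → q (c.eval s)) : Hoare p c c.size q := by
  intro s hs
  obtain ⟨t, ht, hr⟩ := Cmd.Runs.eval hc s
  exact ⟨t, ht, _, hr, h s hs⟩

theorem Hoare.seq {p q r : Store → Prop} {c d : Cmd} {T T' : ℕ} (hc : Hoare p c T q)
    (hd : Hoare q d T' r) : Hoare p (.seq c d) (T + T') r := by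
  intro s hs
  obtain ⟨t, ht, s', hr, hs'⟩ := hc s hs
  obtain ⟨t', ht', s'', hr', hs''⟩ := hd s' hs'
  exact ⟨t + t', add_le_add ht ht', s'', hr.seq hr', hs''⟩

/-- The rule for a loop that is run exactly `K` times: `I k` is the invariant after `k` rounds. -/
theorem Hoare.loop {a : ℕ} {c : Cmd} {T K : ℕ} (I : ℕ → Store → Prop)
    (hpos : ∀ k < K, ∀ s, I k s → 0 < s.reg a) (hexit : ∀ s, I K s → ¬ 0 < s.reg a)
    (hbody : ∀ k < K, Hoare (I k) c T (I (k + 1))) :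
    Hoare (I 0) (.loop a c) (K * (T + 2) + 2) (I K) := by
  suffices H : ∀ j ≤ K, Hoare (I (K - j)) (.loop a c) (j * (T + 2) + 2) (I K) by
    simpa using H K le_rfl
  intro j
  induction j with
  | zero => exact fun _ s hs => ⟨2, by simp, s, .loop_exit (hexit s (by simpa using hs)), hs⟩
  | succ j ih =>
    intro hj s hs
    have hlt : K - (j + 1) < K := by omega
    obtain ⟨t, ht, s', hr, hs'⟩ := hbody _ hlt s hs
    rw [show K - (j + 1) + 1 = K - j by omega] at hs'
    obtain ⟨t', ht', s'', hr', hs''⟩ := ih (by omega) s' hs'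
    refine ⟨t + 2 + t', ?_, s'', .loop_step (hpos _ hlt s hs) hr hr', hs''⟩
    rw [add_mul]
    omega

theorem Hoare.mono {p p' q q' : Store → Prop} {c : Cmd} {T T' : ℕ} (h : Hoare p c T q)
    (hp : ∀ s, p' s → p s) (hT : T ≤ T') (hq : ∀ s, q s → q' s) : Hoare p' c T' q' := by
  intro s hs
  obtain ⟨t, ht, s', hr, hs'⟩ := h s (hp s hs)
  exact ⟨t, ht.trans hT, s', hr, hq s' hs'⟩

/-- The compiled program satisfies what the logic proves about the structured one. -/
theorem Hoare.haltsWithin {p q : Store → Prop} {c : Cmd} {T : ℕ} (h : Hoare p c T q)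
    {M : ℕ → ℤ} (hM : p ⟨fun _ => 0, M⟩) {T' : ℝ} (hT : (T : ℝ) ≤ T') :
    ∃ s, q s ∧ Program.HaltsWithin (c.compile 0) M T' s.mem := by
  obtain ⟨t, ht, s, hr, hs⟩ := h _ hM
  have hrun : (c.compile 0).step^[t] (start M) = s.at (0 + c.size) :=
    hr (c.compile 0) 0 (fun k i hk => by simpa using hk)
  refine ⟨s, hs, t, le_trans (by exact_mod_cast ht) hT, ?_, ?_⟩
  · rw [hrun, Program.Halted, Cmd.length_compile, zero_add]
    rfl
  · rw [hrun]
    rfl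

end RAM

namespace PipageRounding

open Finset

/-! ### The rounding procedure and its potential function -/

/-- The state of the rounding procedure after some columns have been read: exactly one of them,
`j`, is still active. -/
structure State where
  /-- The active column. -/
  j : ℕ
  /-- The column that was fixed last. -/
  f : ℕ
  /-- The value, `0` or `1`, that column `f` was fixed to. -/
  v : ℤ
  /-- The present value of the active column, in `[0, 1]`. -/
  c : ℚ
  /-- The weights of the rows, up to the factors for column `f`, which are still to be
  multiplied in. -/
  q : ℕ → ℚ
  /-- The values of the fixed columns. -/
  y : ℕ → ℤ

/-- No column has been read. Column `0` is declared active with value `0`, so that reading column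
`0` needs no special treatment: it is paired with itself. -/
def State.init : State := ⟨0, 0, 0, 0, fun _ => 1, fun _ => 0⟩

variable (a : ℕ → ℕ → ℚ) (x : ℕ → ℚ) (δ : ℚ) (m : ℕ)

/-- The weight of row `r` when column `i` is read: the product of `1 + δ a r k y k` over the fixed
columns `k`, divided by the product of `1 + δ a r k x k` over all columns `k ≤ i`. -/
def State.weight (st : State) (i r : ℕ) : ℚ :=
  st.q r * (1 + st.v * δ * a r st.f) / (1 + δ * a r i * x i)

/-- The weighted cost of the active column `j` minus the weighted cost of column `i`. -/
def State.slope (st : State) (i : ℕ) : ℚ :=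
  ∑ r ∈ range m, st.weight a x δ i r * (a r st.j - a r i)

/-- Column `i` gets fixed if and only if this quantity is positive; otherwise the active column
is. -/
def State.criterion (st : State) (i : ℕ) : ℚ :=
  if 1 < st.c + x i then st.slope a x δ m i else -st.slope a x δ m i

/-- Column `i` is read. Mass is shifted between the active column and column `i` until one of the
two is integral; of the two ways to do so the one that does not increase the potential is taken. -/
def State.next (st : State) (i : ℕ) : State :=
  let f := if 0 < st.criterion a x δ m i then i else st.j
  let v := if 1 < st.c + x i then 1 else 0
  { j := if 0 < st.criterion a x δ m i then st.j else i
    f := f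
    v := v
    c := if 1 < st.c + x i then st.c + x i - 1 else st.c + x i
    q := st.weight a x δ i
    y := Function.update st.y f v }

/-- The state after columns `0, …, i - 1` have been read. -/
def State.after : ℕ → State
  | 0 => State.init
  | i + 1 => (State.after i).next a x δ m i

/-- The last active column is fixed to its value, which is integral by then. -/
def State.output (st : State) : ℕ → ℤ :=
  Function.update st.y st.j (if 0 < st.c then 1 else 0)

/-- The properties of the state after `i` columns, `i ≥ 1`. In `prod_eq` and `potential_le` the
factor for column `f`, which `q` still lacks, is multiplied in. -/
structure Invariant (i : ℕ) (st : State) : Prop where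
  j_lt : st.j < i
  c_nonneg : 0 ≤ st.c
  c_le_one : st.c ≤ 1
  v_nonneg : 0 ≤ st.v
  y_zero_or_one : ∀ k, st.y k = 0 ∨ st.y k = 1
  sum_eq : ∑ k ∈ (range i).erase st.j, (st.y k : ℚ) + st.c = ∑ k ∈ range i, x k
  q_pos : ∀ r < m, 0 < st.q r
  prod_eq : ∀ r < m, st.q r * (1 + st.v * δ * a r st.f) * ∏ k ∈ range i, (1 + δ * a r k * x k) =
    ∏ k ∈ (range i).erase st.j, (1 + δ * a r k * st.y k)
  potential_le : ∑ r ∈ range m,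
    st.q r * (1 + st.v * δ * a r st.f) * (1 + δ * a r st.j * st.c) ≤ m

variable {a x δ m}

theorem Invariant.one (hδ : 0 ≤ δ) (ha : ∀ r k, 0 ≤ a r k) (hx : ∀ k, 0 ≤ x k)
    (hx' : ∀ k, x k ≤ 1) : Invariant a x δ m 1 (State.after a x δ m 1) := by
  have hpos : ∀ r, 0 < 1 + δ * a r 0 * x 0 := fun r => by
    have := mul_nonneg (mul_nonneg hδ (ha r 0)) (hx 0)
    linarith
  have hj : (State.after a x δ m 1).j = 0 := ite_self 0
  have hf : (State.after a x δ m 1).f = 0 := ite_self 0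
  have hnot : ¬ 1 < x 0 := not_lt.2 (hx' 0)
  have hv : (State.after a x δ m 1).v = 0 := by
    simp [State.after, State.next, State.init, hnot]
  have hc : (State.after a x δ m 1).c = x 0 := by
    simp [State.after, State.next, State.init, hnot]
  have hq : ∀ r, (State.after a x δ m 1).q r = (1 + δ * a r 0 * x 0)⁻¹ := fun r => by
    simp [State.after, State.next, State.init, State.weight]
  have hy : ∀ k, (State.after a x δ m 1).y k = 0 := fun k => by
    simp [State.after, State.next, State.init, hnot]
  have he : (range 1).erase 0 = ∅ := rfl
  constructor
  · simp [hj]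
  · simpa [hc] using hx 0
  · simpa [hc] using hx' 0
  · simp [hv]
  · simp [hy]
  · simp [hj, hc]
  · intro r _
    rw [hq]
    exact inv_pos.2 (hpos r)
  · intro r _
    rw [hq, hv, hj, he]
    have := (hpos r).ne'
    simp [this]
  · have : ∀ r, (1 + δ * a r 0 * x 0)⁻¹ * (1 + δ * a r 0 * x 0) = 1 :=
      fun r => inv_mul_cancel₀ (hpos r).ne'
    simp [hq, hv, hj, hc, this]

/-- The potential, as a function of how the mass `c + x` is split between a column with entries `p`
and one with entries `b`, is concave, so one of the two extreme splits does not increase it. The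
sign of the slope tells which. -/
theorem sum_le_sum_of_split {w p b : ℕ → ℚ} {c x κ : ℚ} {g : ℕ → ℚ}
    (hκ : 0 ≤ κ * ∑ r ∈ range m, w r * (p r - b r))
    (hg : ∀ r < m, g r + κ * (w r * (p r - b r)) ≤
      w r * (1 + δ * b r * x) * (1 + δ * p r * c)) :
    ∑ r ∈ range m, g r ≤ ∑ r ∈ range m, w r * (1 + δ * b r * x) * (1 + δ * p r * c) := by
  rw [mul_sum] at hκ
  calc ∑ r ∈ range m, g r
      ≤ ∑ r ∈ range m, g r + ∑ r ∈ range m, κ * (w r * (p r - b r)) := le_add_of_nonneg_right hκ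
    _ = ∑ r ∈ range m, (g r + κ * (w r * (p r - b r))) := sum_add_distrib.symm
    _ ≤ _ := sum_le_sum fun r hr => hg r (mem_range.1 hr)

theorem potential_next_le {i : ℕ} {st : State} (hδ : 0 ≤ δ) (ha : ∀ r k, 0 ≤ a r k)
    (hx : ∀ k, 0 ≤ x k) (hx' : ∀ k, x k ≤ 1) (hc : 0 ≤ st.c) (hc' : st.c ≤ 1)
    (hw : ∀ r < m, 0 < st.weight a x δ i r) :
    ∑ r ∈ range m, (st.next a x δ m i).q r *
        (1 + (st.next a x δ m i).v * δ * a r (st.next a x δ m i).f) *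
        (1 + δ * a r (st.next a x δ m i).j * (st.next a x δ m i).c) ≤
      ∑ r ∈ range m, st.weight a x δ i r * (1 + δ * a r i * x i) * (1 + δ * a r st.j * st.c) := by
  -- The two second-order terms that concavity allows to drop.
  have h2 : ∀ r < m, 0 ≤ st.weight a x δ i r * (δ * a r st.j * (δ * a r i) * (st.c * x i)) :=
    fun r hr => mul_nonneg (hw r hr).le (mul_nonneg (mul_nonneg (mul_nonneg hδ (ha _ _))
      (mul_nonneg hδ (ha _ _))) (mul_nonneg hc (hx i)))
  have h2' : ∀ r < m, 0 ≤ st.weight a x δ i r *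
      (δ * a r st.j * (δ * a r i) * ((1 - st.c) * (1 - x i))) :=
    fun r hr => mul_nonneg (hw r hr).le (mul_nonneg (mul_nonneg (mul_nonneg hδ (ha _ _))
      (mul_nonneg hδ (ha _ _))) (mul_nonneg (sub_nonneg.2 hc') (sub_nonneg.2 (hx' i))))
  have hcr : st.criterion a x δ m i =
    if 1 < st.c + x i then st.slope a x δ m i else -st.slope a x δ m i := rfl
  have hs : st.slope a x δ m i = ∑ r ∈ range m, st.weight a x δ i r * (a r st.j - a r i) := rfl
  simp only [State.next]
  by_cases h1 : 1 < st.c + x i <;> by_cases ht : 0 < st.criterion a x δ m i <;>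
    simp only [h1, ht, if_true, if_false, Int.cast_one, Int.cast_zero] at hcr ⊢
  · refine sum_le_sum_of_split (κ := δ * (1 - x i)) ?_ fun r hr => ?_
    · rw [← hs, ← hcr]
      exact mul_nonneg (mul_nonneg hδ (sub_nonneg.2 (hx' i))) ht.le
    · linear_combination h2' r hr
  · refine sum_le_sum_of_split (κ := -(δ * (1 - st.c))) ?_ fun r hr => ?_
    · rw [← hs, ← hcr]
      exact mul_nonneg_of_nonpos_of_nonpos
        (neg_nonpos.2 (mul_nonneg hδ (sub_nonneg.2 hc'))) (not_lt.1 ht)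
    · linear_combination h2' r hr
  · refine sum_le_sum_of_split (κ := -(δ * x i)) ?_ fun r hr => ?_
    · rw [← hs, neg_mul_comm, ← hcr]
      exact mul_nonneg (mul_nonneg hδ (hx i)) ht.le
    · linear_combination h2 r hr
  · refine sum_le_sum_of_split (κ := δ * st.c) ?_ fun r hr => ?_
    · rw [← hs]
      rw [hcr] at ht
      exact mul_nonneg (mul_nonneg hδ hc) (by linarith)
    · linear_combination h2 r hr

theorem Invariant.next {i : ℕ} {st : State} (hδ : 0 ≤ δ) (ha : ∀ r k, 0 ≤ a r k)
    (hx : ∀ k, 0 ≤ x k) (hx' : ∀ k, x k ≤ 1) (h : Invariant a x δ m i st) :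
    Invariant a x δ m (i + 1) (st.next a x δ m i) := by
  have hpos : ∀ r, 0 < 1 + δ * a r i * x i := fun r => by
    have := mul_nonneg (mul_nonneg hδ (ha r i)) (hx i)
    linarith
  have hposv : ∀ r, 0 < 1 + st.v * δ * a r st.f := fun r => by
    have : (0 : ℚ) ≤ st.v := by exact_mod_cast h.v_nonneg
    have := mul_nonneg (mul_nonneg this hδ) (ha r st.f)
    linarith
  have hw : ∀ r < m, 0 < st.weight a x δ i r := fun r hr =>
    div_pos (mul_pos (h.q_pos r hr) (hposv r)) (hpos r)
  have hwq : ∀ r, st.weight a x δ i r * (1 + δ * a r i * x i) =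
      st.q r * (1 + st.v * δ * a r st.f) := fun r => div_mul_cancel₀ _ (hpos r).ne'
  have hji : st.j < i := h.j_lt
  -- The columns fixed after the step are those fixed before and the column `f` of the new state.
  obtain ⟨hf, herase⟩ : (st.next a x δ m i).f ∉ (range i).erase st.j ∧
      (range (i + 1)).erase (st.next a x δ m i).j =
        insert (st.next a x δ m i).f ((range i).erase st.j) := by
    simp only [State.next]
    split_ifs
    · refine ⟨by simp, ?_⟩
      rw [range_add_one, erase_insert_of_ne (by omega)]
    · refine ⟨by simp, ?_⟩
      rw [insert_erase (mem_range.2 hji), range_add_one, erase_insert (by simp)]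
  have hy : ∀ k ∈ (range i).erase st.j, (st.next a x δ m i).y k = st.y k := fun k hk =>
    Function.update_of_ne (ne_of_mem_of_not_mem hk hf) _ _
  have hyf : (st.next a x δ m i).y (st.next a x δ m i).f = (st.next a x δ m i).v :=
    Function.update_self _ _ _
  have hv : (st.next a x δ m i).v = 0 ∧ (st.next a x δ m i).c = st.c + x i ∧ st.c + x i ≤ 1 ∨
      (st.next a x δ m i).v = 1 ∧ (st.next a x δ m i).c = st.c + x i - 1 ∧ 1 < st.c + x i := by
    by_cases h1 : 1 < st.c + x i
    · right; simp [State.next, h1]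
    · left; simp [State.next, h1, not_lt.1 h1]
  have hx0 := hx i
  have hx1 := hx' i
  have hc0 := h.c_nonneg
  have hc1 := h.c_le_one
  constructor
  · simp only [State.next]
    split_ifs <;> omega
  · rcases hv with ⟨-, hc, h1⟩ | ⟨-, hc, h1⟩ <;> rw [hc] <;> linarith
  · rcases hv with ⟨-, hc, h1⟩ | ⟨-, hc, h1⟩ <;> rw [hc] <;> linarith
  · rcases hv with ⟨hv, -⟩ | ⟨hv, -⟩ <;> simp [hv]
  · intro k
    by_cases hk : k = (st.next a x δ m i).f
    · rw [hk, hyf]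
      exact hv.imp And.left And.left
    · have : (st.next a x δ m i).y k = st.y k := Function.update_of_ne hk _ _
      rw [this]
      exact h.y_zero_or_one k
  · rw [herase, sum_insert hf, hyf, sum_congr rfl fun k hk => by rw [hy k hk], sum_range_succ,
      ← h.sum_eq]
    rcases hv with ⟨hv, hc, -⟩ | ⟨hv, hc, -⟩ <;> rw [hv, hc] <;> push_cast <;> ring
  · exact hw
  · intro r hr
    have hprod : ∏ k ∈ (range i).erase st.j, (1 + δ * a r k * (st.next a x δ m i).y k) =
        ∏ k ∈ (range i).erase st.j, (1 + δ * a r k * st.y k) :=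
      prod_congr rfl fun k hk => by rw [hy k hk]
    rw [herase, prod_insert hf, hyf, hprod, prod_range_succ, ← h.prod_eq r hr, ← hwq r]
    simp only [State.next]
    ring
  · refine (potential_next_le hδ ha hx hx' hc0 hc1 hw).trans ?_
    simp only [hwq]
    exact h.potential_le

theorem Invariant.after (hδ : 0 ≤ δ) (ha : ∀ r k, 0 ≤ a r k) (hx : ∀ k, 0 ≤ x k)
    (hx' : ∀ k, x k ≤ 1) {n : ℕ} (hn : 1 ≤ n) :
    Invariant a x δ m n (State.after a x δ m n) := by
  induction n, hn using Nat.le_induction with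
  | base => exact Invariant.one hδ ha hx hx'
  | succ n _ ih => exact ih.next hδ ha hx hx'

/-- The last active column has an integral value because the total mass is an integer. -/
theorem Invariant.output_j {n : ℕ} {st : State} (h : Invariant a x δ m n st)
    (hsum : ∃ k : ℤ, ∑ i ∈ range n, x i = k) : (st.output st.j : ℚ) = st.c := by
  obtain ⟨k, hk⟩ := hsum
  have hc : st.c = ((k - ∑ i ∈ (range n).erase st.j, st.y i : ℤ) : ℚ) := by
    push_cast
    linarith [h.sum_eq]
  have h0 := h.c_nonneg
  have h1 := h.c_le_one
  rw [State.output, Function.update_self]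
  rw [hc] at h0 h1 ⊢
  norm_cast at h0 h1 ⊢
  split_ifs <;> omega

theorem State.output_of_ne {st : State} {k : ℕ} (hk : k ≠ st.j) : st.output k = st.y k :=
  Function.update_of_ne hk _ _

theorem Invariant.output_zero_or_one {n : ℕ} {st : State} (h : Invariant a x δ m n st) (k : ℕ) :
    st.output k = 0 ∨ st.output k = 1 := by
  by_cases hk : k = st.j
  · rw [hk, State.output, Function.update_self]
    split_ifs <;> simp
  · rw [State.output_of_ne hk]
    exact h.y_zero_or_one k

theorem Invariant.sum_output {n : ℕ} {st : State} (h : Invariant a x δ m n st)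
    (hsum : ∃ k : ℤ, ∑ i ∈ range n, x i = k) :
    ∑ k ∈ range n, (st.output k : ℚ) = ∑ k ∈ range n, x k := by
  rw [← sum_erase_add _ _ (mem_range.2 h.j_lt), h.output_j hsum, ← h.sum_eq]
  congr 1
  exact sum_congr rfl fun k hk => by rw [State.output_of_ne (ne_of_mem_erase hk)]

theorem Invariant.prod_output_le {n : ℕ} {st : State} (h : Invariant a x δ m n st)
    (hδ : 0 ≤ δ) (ha : ∀ r k, 0 ≤ a r k) (hx : ∀ k, 0 ≤ x k)
    (hsum : ∃ k : ℤ, ∑ i ∈ range n, x i = k) {r : ℕ} (hr : r < m) :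
    ∏ k ∈ range n, (1 + δ * a r k * st.output k) ≤
      m * ∏ k ∈ range n, (1 + δ * a r k * x k) := by
  have hprod : 0 < ∏ k ∈ range n, (1 + δ * a r k * x k) := prod_pos fun k _ => by
    have := mul_nonneg (mul_nonneg hδ (ha r k)) (hx k)
    linarith
  have hterm : ∀ r < m, 0 ≤ st.q r * (1 + st.v * δ * a r st.f) * (1 + δ * a r st.j * st.c) := by
    intro r hr
    have hv : (0 : ℚ) ≤ st.v := by exact_mod_cast h.v_nonneg
    have h1 := mul_nonneg (mul_nonneg hv hδ) (ha r st.f)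
    have h2 := mul_nonneg (mul_nonneg hδ (ha r st.j)) h.c_nonneg
    exact mul_nonneg (mul_nonneg (h.q_pos r hr).le (by linarith)) (by linarith)
  have hle : st.q r * (1 + st.v * δ * a r st.f) * (1 + δ * a r st.j * st.c) ≤ m :=
    (single_le_sum (fun r hr => hterm r (mem_range.1 hr)) (mem_range.2 hr)).trans h.potential_le
  calc ∏ k ∈ range n, (1 + δ * a r k * st.output k)
      = (∏ k ∈ (range n).erase st.j, (1 + δ * a r k * st.y k)) * (1 + δ * a r st.j * st.c) := by
        rw [← prod_erase_mul _ _ (mem_range.2 h.j_lt), h.output_j hsum]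
        congr 1
        exact prod_congr rfl fun k hk => by rw [State.output_of_ne (ne_of_mem_erase hk)]
    _ = st.q r * (1 + st.v * δ * a r st.f) * (1 + δ * a r st.j * st.c) *
          ∏ k ∈ range n, (1 + δ * a r k * x k) := by
        rw [← h.prod_eq r hr]
        ring
    _ ≤ _ := mul_le_mul_of_nonneg_right hle hprod.le

/-! ### From the potential to the bound on the rows -/

/-- Chernoff-type estimate: logarithms turn the bound on the products into one on the sums. -/
theorem sum_mul_log_le {n m : ℕ} {d : ℝ} (hd : 0 ≤ d) {b : ℕ → ℝ} {y : ℕ → ℤ} {x : ℕ → ℝ}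
    (hb : ∀ k, 0 ≤ b k) (hb' : ∀ k, b k ≤ 1) (hy : ∀ k, y k = 0 ∨ y k = 1) (hx : ∀ k, 0 ≤ x k)
    (hm : 1 ≤ m) (h : ∏ k ∈ range n, (1 + d * b k * y k) ≤
      m * ∏ k ∈ range n, (1 + d * b k * x k)) :
    (∑ k ∈ range n, b k * y k) * Real.log (1 + d) ≤
      Real.log m + d * ∑ k ∈ range n, b k * x k := by
  have hpx : ∀ k, 0 < 1 + d * b k * x k := fun k => by
    have := mul_nonneg (mul_nonneg hd (hb k)) (hx k)
    linarith
  have hy0 : ∀ k, (0 : ℝ) ≤ y k := fun k => by rcases hy k with e | e <;> simp [e]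
  have hpy : ∀ k, 0 < 1 + d * b k * y k := fun k => by
    have := mul_nonneg (mul_nonneg hd (hb k)) (hy0 k)
    linarith
  have hm0 : (0 : ℝ) < m := by exact_mod_cast hm
  have hlog := Real.log_le_log (prod_pos fun k _ => hpy k) h
  rw [Real.log_mul hm0.ne' (prod_pos fun k _ => hpx k).ne',
    Real.log_prod fun k _ => (hpx k).ne', Real.log_prod fun k _ => (hpy k).ne'] at hlog
  calc (∑ k ∈ range n, b k * y k) * Real.log (1 + d)
      = ∑ k ∈ range n, b k * y k * Real.log (1 + d) := sum_mul ..
    _ ≤ ∑ k ∈ range n, Real.log (1 + d * b k * y k) := by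
        refine sum_le_sum fun k _ => ?_
        rcases hy k with e | e
        · simp [e]
        · -- Bernoulli: `(1 + d) ^ b ≤ 1 + b d` for `b ∈ [0, 1]`.
          have := Real.log_le_log (Real.rpow_pos_of_pos (by linarith) _)
            (rpow_one_add_le_one_add_mul_self (by linarith : -1 ≤ d) (hb k) (hb' k))
          rw [Real.log_rpow (by linarith), mul_comm (b k) d] at this
          simpa [e] using this
    _ ≤ Real.log m + ∑ k ∈ range n, Real.log (1 + d * b k * x k) := hlog
    _ ≤ Real.log m + ∑ k ∈ range n, d * b k * x k := by
        gcongr with k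
        linarith [Real.log_le_sub_one_of_pos (hpx k)]
    _ = Real.log m + d * ∑ k ∈ range n, b k * x k := by
        rw [mul_sum]
        simp only [mul_assoc]

/-- The value of `δ`: the least `d ≥ 1` with `m ≤ 2 ^ d`. -/
def delta (m : ℕ) : ℕ := max 1 (Nat.clog 2 m)

theorem one_le_delta (m : ℕ) : 1 ≤ delta m := le_max_left _ _

theorem le_two_pow_delta (m : ℕ) : m ≤ 2 ^ delta m :=
  (Nat.le_pow_clog (by norm_num) m).trans (Nat.pow_le_pow_right (by norm_num) (le_max_right _ _))

theorem two_pow_lt_of_lt_delta {m k : ℕ} (hk : k + 1 < delta m) : 2 ^ (k + 1) < m := by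
  have : k + 1 < Nat.clog 2 m := by
    rw [delta] at hk
    omega
  exact (Nat.lt_clog_iff_pow_lt (by norm_num)).1 this

theorem delta_le {m : ℕ} (hm : 1 ≤ m) : delta m ≤ m := by
  by_contra! h
  obtain ⟨d, hd⟩ : ∃ d, delta m = d + 2 := ⟨delta m - 2, by omega⟩
  have h1 := two_pow_lt_of_lt_delta (m := m) (k := d) (by omega)
  have h2 := Nat.lt_two_pow_self (n := d + 1)
  omega

/-- With `δ` of the order of `log m`, the estimate gives the factor `log m / log log m`. -/
theorem le_of_mul_log_le {m : ℕ} (hm : 1 ≤ m) {s μ : ℝ}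
    (h : s * Real.log (1 + delta m) ≤ Real.log m + delta m * μ) :
    s ≤ 4 * (max 1 μ * (Real.log (max (m : ℝ) 3) / Real.log (Real.log (max (m : ℝ) 3)))) := by
  set L := Real.log (max (m : ℝ) 3) with hL
  have hm0 : (0 : ℝ) < m := by exact_mod_cast hm
  have hL1 : 1 < L := by
    rw [hL, Real.lt_log_iff_exp_lt (by positivity)]
    exact lt_of_lt_of_le (Real.exp_one_lt_d9.trans (by norm_num)) (le_max_right _ _)
  have hLL : 0 < Real.log L := Real.log_pos hL1
  have hmL : Real.log m ≤ L := Real.log_le_log hm0 (le_max_left _ _)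
  have hd1 : (1 : ℝ) ≤ delta m := by exact_mod_cast one_le_delta m
  have hlog2 : Real.log 2 < 0.7 := Real.log_two_lt_d9.trans (by norm_num)
  have hlog2' : 0.6 < Real.log 2 := lt_trans (by norm_num) Real.log_two_gt_d9
  have hlow : L ≤ 1 + delta m := by
    have h3 : Real.log 3 ≤ 1 + delta m := by
      have : Real.log 3 ≤ 3 - 1 := Real.log_le_sub_one_of_pos (by norm_num)
      linarith
    have hmd : Real.log m ≤ 1 + delta m := by
      have hpow : (m : ℝ) ≤ 2 ^ delta m := by exact_mod_cast le_two_pow_delta m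
      have := Real.log_le_log hm0 hpow
      rw [Real.log_pow] at this
      nlinarith
    rw [hL]
    rcases max_choice (m : ℝ) 3 with e | e <;> rw [e] <;> assumption
  have hupp : delta m ≤ 3 * L := by
    rcases Nat.lt_or_ge 1 (delta m) with h1 | h1
    · obtain ⟨d, hd⟩ : ∃ d, delta m = d + 2 := ⟨delta m - 2, by omega⟩
      have hpow : (2 : ℝ) ^ (d + 1) ≤ m := by
        exact_mod_cast (two_pow_lt_of_lt_delta (m := m) (k := d) (by omega)).le
      have := Real.log_le_log (by positivity) hpow
      rw [Real.log_pow] at this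
      have hnn : (0 : ℝ) ≤ d := Nat.cast_nonneg _
      rw [hd]
      push_cast at this ⊢
      nlinarith
    · have : (delta m : ℝ) ≤ 1 := by exact_mod_cast h1
      linarith
  have hlogd : Real.log L ≤ Real.log (1 + delta m) := Real.log_le_log (by linarith) hlow
  have hM : (1 : ℝ) ≤ max 1 μ := le_max_left _ _
  have hMμ : μ ≤ max 1 μ := le_max_right _ _
  rw [← mul_div_assoc, ← mul_div_assoc, le_div_iff₀ hLL]
  rcases le_or_gt s 0 with hs | hs
  · exact (mul_nonpos_of_nonpos_of_nonneg hs hLL.le).trans (by positivity)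
  · have h1 : delta m * μ ≤ 3 * L * max 1 μ :=
      (mul_le_mul_of_nonneg_left hMμ (by linarith)).trans
        (mul_le_mul_of_nonneg_right hupp (by linarith))
    have h2 : L ≤ L * max 1 μ := le_mul_of_one_le_right (by linarith) hM
    calc s * Real.log L ≤ s * Real.log (1 + delta m) := mul_le_mul_of_nonneg_left hlogd hs.le
      _ ≤ Real.log m + delta m * μ := h
      _ ≤ 4 * (max 1 μ * L) := by linarith

end PipageRounding

namespace PipageRounding

open Finset RAM

/-! ### The program -/

namespace Reg

/-- The constant `0`. -/
@[simp] def zero : ℕ := 0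

/-- The constant `1`. -/
@[simp] def one : ℕ := 1

/-- The constant `2`. -/
@[simp] def two : ℕ := 2

/-- The number of rows. -/
@[simp] def m : ℕ := 3

/-- The number of columns. -/
@[simp] def n : ℕ := 4

/-- The number `2 n` of cells of a row of the matrix. -/
@[simp] def rowLen : ℕ := 5

/-- The distance between the cells of `a 0 i` and of `x i`. -/
@[simp] def xOff : ℕ := 6

/-- The first cell of the weights. -/
@[simp] def wBase : ℕ := 7

/-- The distance between the cells of `a 0 i` and of `y i`. -/
@[simp] def yOff : ℕ := 8

/-- The parameter `δ`. -/
@[simp] def d : ℕ := 9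

/-- The number of rounds left in the loop over the columns and in the one that copies. -/
@[simp] def k : ℕ := 10

/-- The address of `a 0 i`, where `i` is the column being read. -/
@[simp] def colI : ℕ := 11

/-- The address of `a 0 j`, where `j` is the active column. -/
@[simp] def colJ : ℕ := 12

/-- The address of `a 0 f`, where `f` is the column fixed last. -/
@[simp] def colF : ℕ := 13

/-- The value that column `f` was fixed to. -/
@[simp] def v : ℕ := 14

/-- The numerator of the value of the active column. -/
@[simp] def cn : ℕ := 15

/-- The denominator of the value of the active column. -/
@[simp] def cd : ℕ := 16

/-- The numerator of `x i`. -/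
@[simp] def xn : ℕ := 17

/-- The denominator of `x i`. -/
@[simp] def xd : ℕ := 18

/-- The address of the entry of column `i` in the current row. -/
@[simp] def pI : ℕ := 19

/-- The address of the entry of column `j` in the current row. -/
@[simp] def pJ : ℕ := 20

/-- The address of the entry of column `f` in the current row. -/
@[simp] def pF : ℕ := 21

/-- The address of the weight of the current row. -/
@[simp] def pW : ℕ := 22

/-- The number of rows left. -/
@[simp] def cnt : ℕ := 23

/-- The numerator of the partial sum for the slope. -/
@[simp] def sn : ℕ := 24

/-- The denominator of the partial sum for the slope. -/
@[simp] def sd : ℕ := 25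

/-- Auxiliary register. -/
@[simp] def t : ℕ := 26

/-- Auxiliary register. -/
@[simp] def u : ℕ := 27

/-- The numerator of the entry of column `f`. -/
@[simp] def aF : ℕ := 28

/-- The denominator of the entry of column `f`. -/
@[simp] def bF : ℕ := 29

/-- The numerator of the entry of column `j`. -/
@[simp] def aJ : ℕ := 30

/-- The denominator of the entry of column `j`. -/
@[simp] def bJ : ℕ := 31

/-- The numerator of the entry of column `i`. -/
@[simp] def aI : ℕ := 32

/-- The denominator of the entry of column `i`. -/
@[simp] def bI : ℕ := 33

/-- The numerator of the weight. -/
@[simp] def wn : ℕ := 34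

/-- The denominator of the weight. -/
@[simp] def wd : ℕ := 35

end Reg

namespace Code

open Reg

/-- Computes the constants and prepares the loop that finds `δ`. -/
def setup : Cmd := .block
  [.const one 1, .const two 2, .load m zero, .load n one, .add rowLen n n, .mul xOff m rowLen,
   .add wBase two xOff, .add wBase wBase rowLen, .add yOff xOff rowLen, .add yOff yOff m,
   .add yOff yOff m, .const d 1, .const u 2, .sub t m u]

/-- Doubles `u = 2 ^ d` until it is at least `m`. -/
def deltaLoop : Cmd := .loop t (.block [.add u u u, .add d d one, .sub t m u])

/-- The state `State.init`. -/
def initState : Cmd := .block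
  [.const colI 2, .const colJ 2, .const colF 2, .const v 0, .const cn 0, .const cd 1,
   .add k n zero]

/-- Reads `x i` and prepares the loop over the rows. -/
def readX : Cmd := .block
  [.add t colI xOff, .load xn t, .add t t one, .load xd t, .add pI colI zero, .add pJ colJ zero,
   .add pF colF zero, .add pW wBase zero, .add cnt m zero, .const sn 0, .const sd 1]

/-- Updates the weight `wn / wd` of one row and adds the contribution of the row to the slope
`sn / sd`. -/
def row : Cmd := .block
  [.load aF pF, .add t pF one, .load bF t, .load aJ pJ, .add t pJ one, .load bJ t,
   .load aI pI, .add t pI one, .load bI t,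
   .load wn pW, .add wn wn one, .add t pW one, .load wd t, .add wd wd one,
   .mul t v d, .mul t t aF, .add t t bF, .mul wn wn t, .mul t bI xd, .mul wn wn t,
   .mul u aI xn, .mul u u d, .add u u t, .mul wd wd u, .mul wd wd bF,
   .sub t wn one, .store pW t, .add u pW one, .sub t wd one, .store u t,
   .mul t aJ bI, .mul u aI bJ, .sub t t u, .mul t t wn, .mul t t sd,
   .mul u bI bJ, .mul u u wd, .mul sn sn u, .add sn sn t, .mul sd sd u,
   .add pI pI rowLen, .add pJ pJ rowLen, .add pF pF rowLen, .add pW pW two, .sub cnt cnt one]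

/-- Shifts mass between the active column and column `i` and fixes one of them. The first branch
tests the numerator `t` of `c + x i - 1`, the second one `u`, which has the sign of the
criterion. -/
def shift : Cmd :=
  .seq (.block [.mul t cn xd, .mul u xn cd, .add cn t u, .mul cd cd xd, .sub t cn cd])
  (.seq (.ite t (.block [.const v 1, .add cn t zero, .add u sn zero])
          (.block [.const v 0, .sub u zero sn]))
  (.seq (.ite u (.block [.add colF colI zero])
          (.block [.add colF colJ zero, .add colJ colI zero]))
  (.block [.add t colF yOff, .store t v, .add colI colI two, .sub k k one])))

/-- Reads one column. -/
def column : Cmd := .seq readX (.seq (.loop cnt row) shift)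

/-- Fixes the last active column and prepares the copying of the output. -/
def fixLast : Cmd :=
  .seq (.ite cn (.block [.const v 1]) (.block [.const v 0]))
  (.block [.add t colJ yOff, .store t v, .const pI 0, .add pJ yOff two, .add k n zero])

/-- Copies the output to the cells `0, …, n - 1`. -/
def copyLoop : Cmd := .loop k (.block
  [.load v pJ, .store pI v, .add pI pI one, .add pJ pJ two, .sub k k one])

/-- The whole program. -/
def main : Cmd :=
  .seq setup (.seq deltaLoop (.seq initState (.seq (.loop k column) (.seq fixLast copyLoop))))

end Code

/-! ### Correctness of the program -/

/-- The memory contents `M` hold the dimensions `m` and `n`, the matrix `a` and the vector `x`. -/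
structure IsInput (m n : ℕ) (a : ℕ → ℕ → ℚ) (x : ℕ → ℚ) (M : ℕ → ℤ) : Prop where
  m_eq : M 0 = m
  n_eq : M 1 = n
  a_num : ∀ r < m, ∀ i < n, M (2 + 2 * i + r * (2 * n)) = (a r i).num
  a_den : ∀ r < m, ∀ i < n, M (2 + 2 * i + r * (2 * n) + 1) = (a r i).den
  x_num : ∀ i < n, M (2 + 2 * i + m * (2 * n)) = (x i).num
  x_den : ∀ i < n, M (2 + 2 * i + m * (2 * n) + 1) = (x i).den
  eq_zero : ∀ k, 2 + m * (2 * n) + 2 * n ≤ k → M k = 0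

/-- The first cell behind the input. Cells `wAddr m n + 2 * r` and `wAddr m n + 2 * r + 1` hold the
weight of row `r`. -/
def wAddr (m n : ℕ) : ℕ := 2 + m * (2 * n) + 2 * n

/-- The cell in which the value of the fixed column `i` is kept. -/
def yAddr (m n i : ℕ) : ℕ := 2 + 2 * i + (m * (2 * n) + 2 * n + 2 * m)

/-- The weight `q` of row `r` is stored as numerator and positive denominator, both diminished by
`1`, so that the blank memory represents weights `1`. -/
def RowRep (m n : ℕ) (M : ℕ → ℤ) (r : ℕ) (q : ℚ) : Prop :=
  0 < M (wAddr m n + 2 * r + 1) + 1 ∧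
    q = (M (wAddr m n + 2 * r) + 1) / (M (wAddr m n + 2 * r + 1) + 1)

/-- The registers hold the constants computed in the beginning. -/
structure Consts (m n : ℕ) (s : Store) : Prop where
  zero : s.reg Reg.zero = 0
  one : s.reg Reg.one = 1
  two : s.reg Reg.two = 2
  m_eq : s.reg Reg.m = m
  n_eq : s.reg Reg.n = n
  rowLen : s.reg Reg.rowLen = ((2 * n : ℕ) : ℤ)
  xOff : s.reg Reg.xOff = ((m * (2 * n) : ℕ) : ℤ)
  wBase : s.reg Reg.wBase = (wAddr m n : ℤ)
  yOff : s.reg Reg.yOff = ((m * (2 * n) + 2 * n + 2 * m : ℕ) : ℤ)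

/-- The registers and the memory hold the constants and the state `st`, except for its weights;
column `i` is the next one to read. -/
structure Common (m n : ℕ) (M : ℕ → ℤ) (i : ℕ) (st : State) (s : Store) : Prop
    extends Consts m n s where
  d : s.reg Reg.d = (delta m : ℤ)
  k : s.reg Reg.k = (n : ℤ) - i
  colI : s.reg Reg.colI = ((2 + 2 * i : ℕ) : ℤ)
  colJ : s.reg Reg.colJ = ((2 + 2 * st.j : ℕ) : ℤ)
  colF : s.reg Reg.colF = ((2 + 2 * st.f : ℕ) : ℤ)
  v : s.reg Reg.v = st.v
  cd_pos : 0 < s.reg Reg.cd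
  c_eq : st.c = s.reg Reg.cn / s.reg Reg.cd
  mem_input : ∀ k < wAddr m n, s.mem k = M k
  mem_y : ∀ k < n, s.mem (yAddr m n k) = st.y k

/-- The invariant of the loop over the columns. -/
def OuterInv (m n : ℕ) (M : ℕ → ℤ) (i : ℕ) (st : State) (s : Store) : Prop :=
  Common m n M i st s ∧ ∀ r < m, RowRep m n s.mem r (st.q r)

/-- The invariant of the loop over the rows, when column `i` is read. -/
structure InnerInv (m n : ℕ) (a : ℕ → ℕ → ℚ) (x : ℕ → ℚ) (M : ℕ → ℤ) (i : ℕ) (st : State) (r : ℕ)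
    (s : Store) : Prop where
  common : Common m n M i st s
  xn : s.reg Reg.xn = (x i).num
  xd : s.reg Reg.xd = (x i).den
  pI : s.reg Reg.pI = ((2 + 2 * i + r * (2 * n) : ℕ) : ℤ)
  pJ : s.reg Reg.pJ = ((2 + 2 * st.j + r * (2 * n) : ℕ) : ℤ)
  pF : s.reg Reg.pF = ((2 + 2 * st.f + r * (2 * n) : ℕ) : ℤ)
  pW : s.reg Reg.pW = ((wAddr m n + 2 * r : ℕ) : ℤ)
  cnt : s.reg Reg.cnt = (m : ℤ) - r
  sd_pos : 0 < s.reg Reg.sd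
  slope : ∑ l ∈ range r, st.weight a x (delta m) i l * (a l st.j - a l i) =
    s.reg Reg.sn / s.reg Reg.sd
  rows_done : ∀ l < r, RowRep m n s.mem l (st.weight a x (delta m) i l)
  rows_left : ∀ l < m, r ≤ l → RowRep m n s.mem l (st.q l)

theorem Consts.eval {m n : ℕ} {s : Store} (h : Consts m n s) {c : Cmd}
    (hc : ∀ k < 9, c.writes k = false) : Consts m n (c.eval s) where
  zero := (Cmd.eval_reg (hc _ (by simp)) s).trans h.zero
  one := (Cmd.eval_reg (hc _ (by simp)) s).trans h.one
  two := (Cmd.eval_reg (hc _ (by simp)) s).trans h.two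
  m_eq := (Cmd.eval_reg (hc _ (by simp)) s).trans h.m_eq
  n_eq := (Cmd.eval_reg (hc _ (by simp)) s).trans h.n_eq
  rowLen := (Cmd.eval_reg (hc _ (by simp)) s).trans h.rowLen
  xOff := (Cmd.eval_reg (hc _ (by simp)) s).trans h.xOff
  wBase := (Cmd.eval_reg (hc _ (by simp)) s).trans h.wBase
  yOff := (Cmd.eval_reg (hc _ (by simp)) s).trans h.yOff

theorem setup_hoare {m n : ℕ} {a : ℕ → ℕ → ℚ} {x : ℕ → ℚ} {M : ℕ → ℤ}
    (hM : IsInput m n a x M) :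
    Hoare (fun s => s = ⟨fun _ => 0, M⟩) Code.setup Code.setup.size
      (fun s => Consts m n s ∧ s.mem = M ∧ s.reg Reg.d = 1 ∧ s.reg Reg.u = 2 ∧
        s.reg Reg.t = m - 2) := by
  refine Hoare.eval rfl ?_
  rintro _ rfl
  simp only [Code.setup, Cmd.eval, List.foldl, Instr.effect, Instr.exec, Store.at]
  refine ⟨?_, by simp [hM.m_eq]⟩
  constructor <;> simp [hM.m_eq, hM.n_eq, wAddr, two_mul]
  ring

theorem deltaLoop_hoare {m n : ℕ} {M : ℕ → ℤ} (hm : 1 ≤ m) :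
    Hoare (fun s => Consts m n s ∧ s.mem = M ∧ s.reg Reg.d = 1 ∧ s.reg Reg.u = 2 ∧
        s.reg Reg.t = m - 2) Code.deltaLoop (m * 5 + 2)
      (fun s => Consts m n s ∧ s.mem = M ∧ s.reg Reg.d = (delta m : ℤ)) := by
  have h1 := one_le_delta m
  refine Hoare.mono (Hoare.loop (T := 3) (K := delta m - 1)
    (fun k s => Consts m n s ∧ s.mem = M ∧ s.reg Reg.d = (k : ℤ) + 1 ∧
      s.reg Reg.u = 2 ^ (k + 1) ∧ s.reg Reg.t = m - 2 ^ (k + 1)) ?_ ?_ ?_) ?_ ?_ ?_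
  · rintro k hk s ⟨-, -, -, -, ht⟩
    have := two_pow_lt_of_lt_delta (m := m) (k := k) (by omega)
    rw [ht, sub_pos]
    exact_mod_cast this
  · rintro s ⟨-, -, -, -, ht⟩
    rw [ht, sub_pos, not_lt, Nat.sub_add_cancel h1]
    exact_mod_cast le_two_pow_delta m
  · refine fun k _ => Hoare.eval rfl ?_
    rintro s ⟨hc, hM, hd, hu, -⟩
    refine ⟨hc.eval (by decide), ?_⟩
    have h1 := hc.one
    have hm := hc.m_eq
    simp only [Reg.d, Reg.u, Reg.one, Reg.m] at hd hu h1 hm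
    simp [Cmd.eval, Instr.effect, Instr.exec, Store.at, hM, hd, hu, h1, hm]
    ring
  · rintro s ⟨hc, hM, hd, hu, ht⟩
    exact ⟨hc, hM, hd, hu, ht⟩
  · have := delta_le hm
    gcongr
    omega
  · rintro s ⟨hc, hM, hd, -⟩
    refine ⟨hc, hM, ?_⟩
    rw [hd]
    omega

theorem initState_hoare {m n : ℕ} {a : ℕ → ℕ → ℚ} {x : ℕ → ℚ} {M : ℕ → ℤ}
    (hM : IsInput m n a x M) :
    Hoare (fun s => Consts m n s ∧ s.mem = M ∧ s.reg Reg.d = (delta m : ℤ)) Code.initState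
      Code.initState.size (OuterInv m n M 0 State.init) := by
  refine Hoare.eval rfl ?_
  rintro s ⟨hc, hs, hd⟩
  have hmem : (Code.initState.eval s).mem = M := hs
  have hW : ∀ k, wAddr m n ≤ k → M k = 0 := fun k hk => hM.eq_zero k hk
  have hn := hc.n_eq
  have h0 := hc.zero
  simp only [Reg.n, Reg.zero, Reg.d] at hn h0 hd
  refine ⟨⟨hc.eval (by decide), ?_, ?_, ?_, ?_, ?_, ?_, ?_, ?_, fun k _ => by rw [hmem],
    fun k _ => ?_⟩, fun r _ => ?_⟩
  case refine_9 =>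
    rw [hmem, hW _ (by rw [wAddr, yAddr]; omega)]
    rfl
  case refine_10 =>
    rw [RowRep, hmem, hW _ (by omega), hW _ (by omega)]
    simp [State.init]
  all_goals
    simp [Code.initState, Cmd.eval, Instr.effect, Instr.exec, Store.at, State.init, hn, h0, hd]

theorem Common.eval {m n : ℕ} {M : ℕ → ℤ} {i : ℕ} {st : State} {s : Store}
    (h : Common m n M i st s) {c : Cmd} (hc : ∀ k < 17, c.writes k = false)
    (hmem : ∀ k, k < wAddr m n ∨ wAddr m n + 2 * m ≤ k → (c.eval s).mem k = s.mem k) :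
    Common m n M i st (c.eval s) := by
  have hreg : ∀ k < 17, (c.eval s).reg k = s.reg k := fun k hk => Cmd.eval_reg (hc k hk) s
  refine ⟨h.toConsts.eval fun k hk => hc k (by omega), ?_, ?_, ?_, ?_, ?_, ?_, ?_, ?_,
    fun k hk => (hmem k (.inl hk)).trans (h.mem_input k hk),
    fun k hk => (hmem _ (.inr ?_)).trans (h.mem_y k hk)⟩
  · rw [hreg _ (by simp), h.d]
  · rw [hreg _ (by simp), h.k]
  · rw [hreg _ (by simp), h.colI]
  · rw [hreg _ (by simp), h.colJ]
  · rw [hreg _ (by simp), h.colF]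
  · rw [hreg _ (by simp), h.v]
  · rw [hreg _ (by simp)]
    exact h.cd_pos
  · rw [hreg _ (by simp), hreg _ (by simp), h.c_eq]
  · rw [wAddr, yAddr]
    omega

theorem readX_hoare {m n i : ℕ} {a : ℕ → ℕ → ℚ} {x : ℕ → ℚ} {M : ℕ → ℤ} {st : State}
    (hM : IsInput m n a x M) (hi : i < n) :
    Hoare (OuterInv m n M i st) Code.readX Code.readX.size (InnerInv m n a x M i st 0) := by
  refine Hoare.eval rfl ?_
  rintro s ⟨hc, hrow⟩
  have hmem : (Code.readX.eval s).mem = s.mem := rfl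
  have hA1 : (s.reg Reg.colI + s.reg Reg.xOff).toNat = 2 + 2 * i + m * (2 * n) := by
    rw [hc.colI, hc.xOff]
    omega
  have hA2 : (s.reg Reg.colI + s.reg Reg.xOff + 1).toNat = 2 + 2 * i + m * (2 * n) + 1 := by
    rw [hc.colI, hc.xOff]
    omega
  have hL1 : s.mem (2 + 2 * i + m * (2 * n)) = (x i).num := by
    rw [hc.mem_input _ (by rw [wAddr]; omega), hM.x_num i hi]
  have hL2 : s.mem (2 + 2 * i + m * (2 * n) + 1) = (x i).den := by
    rw [hc.mem_input _ (by rw [wAddr]; omega), hM.x_den i hi]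
  have h0 := hc.zero
  have h1 := hc.one
  have hm := hc.m_eq
  have hI := hc.colI
  have hJ := hc.colJ
  have hF := hc.colF
  have hW := hc.wBase
  simp only [Reg.zero, Reg.one, Reg.m, Reg.colI, Reg.colJ, Reg.colF, Reg.wBase, Reg.xOff]
    at h0 h1 hm hI hJ hF hW hA1 hA2
  refine ⟨hc.eval (by decide) fun k _ => by rw [hmem], ?_, ?_, ?_, ?_, ?_, ?_, ?_, ?_, ?_,
    fun l hl => absurd hl l.not_lt_zero, fun l hl _ => by rw [hmem]; exact hrow l hl⟩
  all_goals
    simp [Code.readX, Cmd.eval, Instr.effect, Instr.exec, Store.at, h0, h1, hm, hA1, hA2, hL1, hL2,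
      -Nat.cast_add]
  all_goals simp [hI, hJ, hF, hW]

/-- The new weight of a row, as a fraction of integers. -/
theorem weight_eq_div {q v d x aF aI : ℚ} {N D nF dF nI dI nx dx : ℚ} (hq : q = N / D)
    (hF : aF = nF / dF) (hI : aI = nI / dI) (hx : x = nx / dx) (hD : D ≠ 0) (hdF : dF ≠ 0)
    (hdI : dI ≠ 0) (hdx : dx ≠ 0) (h : dI * dx + d * nI * nx ≠ 0) :
    q * (1 + v * d * aF) / (1 + d * aI * x) =
      (N * (v * d * nF + dF) * (dI * dx)) / (D * (nI * nx * d + dI * dx) * dF) := by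
  subst hq hF hI hx
  have h' : nI * nx * d + dI * dx ≠ 0 := by
    intro e
    apply h
    linear_combination e
  have h'' : 1 + d * (nI / dI) * (nx / dx) = (nI * nx * d + dI * dx) / (dI * dx) := by
    field_simp
    ring
  rw [h'']
  field_simp
  ring

/-- The new partial sum for the slope, as a fraction of integers. -/
theorem add_mul_sub_eq_div {S w aJ aI : ℚ} {N D nJ dJ nI dI sn sd : ℚ} (hS : S = sn / sd)
    (hw : w = N / D) (hJ : aJ = nJ / dJ) (hI : aI = nI / dI) (hD : D ≠ 0) (hsd : sd ≠ 0)
    (hdJ : dJ ≠ 0) (hdI : dI ≠ 0) :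
    S + w * (aJ - aI) =
      (sn * (dI * dJ * D) + (nJ * dI - nI * dJ) * N * sd) / (sd * (dI * dJ * D)) := by
  subst hS hw hJ hI
  field_simp

theorem row_hoare {m n i r : ℕ} {a : ℕ → ℕ → ℚ} {x : ℕ → ℚ} {M : ℕ → ℤ} {st : State}
    (hM : IsInput m n a x M) (ha : ∀ r k, 0 ≤ a r k) (hx : ∀ k, 0 ≤ x k) (hi : i < n)
    (hj : st.j < n) (hf : st.f < n) (hr : r < m) :
    Hoare (InnerInv m n a x M i st r) Code.row Code.row.size
      (InnerInv m n a x M i st (r + 1)) := by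
  refine Hoare.eval rfl ?_
  intro s h
  have hc := h.common
  have hrow : r * (2 * n) + 2 * n ≤ m * (2 * n) := by
    rw [← Nat.succ_mul]
    exact Nat.mul_le_mul_right _ hr
  -- The addresses of the cells that are read.
  have pF0 : (s.reg Reg.pF).toNat = 2 + 2 * st.f + r * (2 * n) := by rw [h.pF]; omega
  have pF1 : (s.reg Reg.pF + 1).toNat = 2 + 2 * st.f + r * (2 * n) + 1 := by rw [h.pF]; omega
  have pJ0 : (s.reg Reg.pJ).toNat = 2 + 2 * st.j + r * (2 * n) := by rw [h.pJ]; omega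
  have pJ1 : (s.reg Reg.pJ + 1).toNat = 2 + 2 * st.j + r * (2 * n) + 1 := by rw [h.pJ]; omega
  have pI0 : (s.reg Reg.pI).toNat = 2 + 2 * i + r * (2 * n) := by rw [h.pI]; omega
  have pI1 : (s.reg Reg.pI + 1).toNat = 2 + 2 * i + r * (2 * n) + 1 := by rw [h.pI]; omega
  have pW0 : (s.reg Reg.pW).toNat = wAddr m n + 2 * r := by rw [h.pW]; omega
  have pW1 : (s.reg Reg.pW + 1).toNat = wAddr m n + 2 * r + 1 := by rw [h.pW]; omega
  have hA : ∀ k < n, s.mem (2 + 2 * k + r * (2 * n)) = (a r k).num ∧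
      s.mem (2 + 2 * k + r * (2 * n) + 1) = (a r k).den := fun k hk => by
    rw [hc.mem_input _ (by rw [wAddr]; omega), hc.mem_input _ (by rw [wAddr]; omega)]
    exact ⟨hM.a_num r hr k hk, hM.a_den r hr k hk⟩
  obtain ⟨hF0, hF1⟩ := hA _ hf
  obtain ⟨hJ0, hJ1⟩ := hA _ hj
  obtain ⟨hI0, hI1⟩ := hA _ hi
  obtain ⟨hDpos, hq⟩ := h.rows_left r hr le_rfl
  set N := s.mem (wAddr m n + 2 * r) with hN
  set D := s.mem (wAddr m n + 2 * r + 1) with hD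
  have h1 := hc.one
  have h2 := hc.two
  have hd := hc.d
  have hvr := hc.v
  have hxn := h.xn
  have hxd := h.xd
  have hlen := hc.rowLen
  simp only [Reg.one, Reg.two, Reg.d, Reg.v, Reg.xn, Reg.xd, Reg.rowLen, Reg.pF, Reg.pJ, Reg.pI,
    Reg.pW] at h1 h2 hd hvr hxn hxd hlen pF0 pF1 pJ0 pJ1 pI0 pI1 pW0 pW1
  set dF : ℤ := ((a r st.f).den : ℤ) with hdF
  set dJ : ℤ := ((a r st.j).den : ℤ) with hdJ
  set dI : ℤ := ((a r i).den : ℤ) with hdI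
  set dx : ℤ := ((x i).den : ℤ) with hdx
  have hdF0 : 0 < dF := Int.natCast_pos.2 (a r st.f).den_pos
  have hdJ0 : 0 < dJ := Int.natCast_pos.2 (a r st.j).den_pos
  have hdI0 : 0 < dI := Int.natCast_pos.2 (a r i).den_pos
  have hdx0 : 0 < dx := Int.natCast_pos.2 (x i).den_pos
  have eF : a r st.f = (a r st.f).num / dF := (Rat.num_div_den _).symm
  have eJ : a r st.j = (a r st.j).num / dJ := (Rat.num_div_den _).symm
  have eI : a r i = (a r i).num / dI := (Rat.num_div_den _).symm
  have ex : x i = (x i).num / dx := (Rat.num_div_den _).symm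
  clear_value dF dJ dI dx
  -- Numerator and denominator of the new weight.
  obtain ⟨N', hN'⟩ : ∃ N' : ℤ, N' = (N + 1) * (st.v * delta m * (a r st.f).num + dF) * (dI * dx) :=
    ⟨_, rfl⟩
  obtain ⟨D', hD'⟩ : ∃ D' : ℤ, D' = (D + 1) * ((a r i).num * (x i).num * delta m + dI * dx) * dF :=
    ⟨_, rfl⟩
  have hmem : (Code.row.eval s).mem = Function.update (Function.update s.mem
      (wAddr m n + 2 * r) (N' - 1)) (wAddr m n + 2 * r + 1) (D' - 1) := by
    simp [Code.row, Cmd.eval, Instr.effect, Instr.exec, Store.at, pF0, pF1, pI0, pI1, pW0, pW1,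
      hF0, hF1, hI0, hI1, ← hN, ← hD, h1, hd, hvr, hxn, hxd, hN', hD']
  have hsn : (Code.row.eval s).reg Reg.sn = s.reg Reg.sn * (dI * dJ * D') +
      ((a r st.j).num * dI - (a r i).num * dJ) * N' * s.reg Reg.sd := by
    simp [Code.row, Cmd.eval, Instr.effect, Instr.exec, Store.at, pF0, pF1, pI0, pI1, pW0, pW1,
      pJ0, pJ1, hJ0, hJ1, hF0, hF1, hI0, hI1, ← hN, ← hD, h1, hd, hvr, hxn, hxd, hN', hD']
  have hsd : (Code.row.eval s).reg Reg.sd = s.reg Reg.sd * (dI * dJ * D') := by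
    simp [Code.row, Cmd.eval, Instr.effect, Instr.exec, Store.at, pF0, pF1, pI0, pI1, pW0, pW1,
      pJ0, pJ1, hJ0, hJ1, hF0, hF1, hI0, hI1, ← hN, ← hD, h1, hd, hvr, hxn, hxd, hD']
  have hden : 0 < (a r i).num * (x i).num * delta m + dI * dx := by
    have h1 := mul_nonneg (mul_nonneg (Rat.num_nonneg.2 (ha r i)) (Rat.num_nonneg.2 (hx i)))
      (Int.natCast_nonneg (delta m))
    have h2 := mul_pos hdI0 hdx0
    omega
  have hD'0 : 0 < D' := hD' ▸ mul_pos (mul_pos hDpos hden) hdF0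
  have hw : st.weight a x (delta m) i r = N' / D' := by
    rw [State.weight, weight_eq_div hq eF eI ex, hN', hD']
    · push_cast
      ring
    · exact_mod_cast hDpos.ne'
    · exact_mod_cast hdF0.ne'
    · exact_mod_cast hdI0.ne'
    · exact_mod_cast hdx0.ne'
    · have : dI * dx + (delta m : ℤ) * (a r i).num * (x i).num ≠ 0 := by
        rw [add_comm, mul_assoc, mul_comm]
        exact hden.ne'
      exact_mod_cast this
  have hother : ∀ l, l ≠ r → (Code.row.eval s).mem (wAddr m n + 2 * l) =
      s.mem (wAddr m n + 2 * l) ∧ (Code.row.eval s).mem (wAddr m n + 2 * l + 1) =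
      s.mem (wAddr m n + 2 * l + 1) := fun l hl => by
    rw [hmem, Function.update_of_ne (by omega), Function.update_of_ne (by omega),
      Function.update_of_ne (by omega), Function.update_of_ne (by omega)]
    exact ⟨rfl, rfl⟩
  have hregs : ∀ k, Code.row.writes k = false → (Code.row.eval s).reg k = s.reg k :=
    fun k hk => Cmd.eval_reg hk s
  refine ⟨hc.eval (by decide) fun k hk => ?_, ?_, ?_, ?_, ?_, ?_, ?_, ?_, ?_, ?_, fun l hl => ?_,
    fun l hl hl' => ?_⟩
  · rw [hmem, Function.update_of_ne (by omega), Function.update_of_ne (by omega)]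
  · rw [hregs _ (by decide), h.xn]
  · rw [hregs _ (by decide), h.xd]
  · have := h.pI
    simp only [Reg.pI] at this
    simp [Code.row, Cmd.eval, Instr.effect, Instr.exec, Store.at, this, hlen]
    ring
  · have := h.pJ
    simp only [Reg.pJ] at this
    simp [Code.row, Cmd.eval, Instr.effect, Instr.exec, Store.at, this, hlen]
    ring
  · have := h.pF
    simp only [Reg.pF] at this
    simp [Code.row, Cmd.eval, Instr.effect, Instr.exec, Store.at, this, hlen]
    ring
  · have := h.pW
    simp only [Reg.pW] at this
    simp [Code.row, Cmd.eval, Instr.effect, Instr.exec, Store.at, this, h2]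
    ring
  · have := h.cnt
    simp only [Reg.cnt] at this
    simp [Code.row, Cmd.eval, Instr.effect, Instr.exec, Store.at, this, h1]
    ring
  · rw [hsd]
    exact mul_pos h.sd_pos (mul_pos (mul_pos hdI0 hdJ0) hD'0)
  · rw [sum_range_succ, add_mul_sub_eq_div h.slope hw eJ eI, hsn, hsd]
    · push_cast
      rfl
    · exact_mod_cast hD'0.ne'
    · exact_mod_cast h.sd_pos.ne'
    · exact_mod_cast hdJ0.ne'
    · exact_mod_cast hdI0.ne'
  · rcases Nat.lt_succ_iff_lt_or_eq.1 hl with hl | rfl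
    · obtain ⟨e1, e2⟩ := hother l hl.ne
      rw [RowRep, e1, e2]
      exact h.rows_done l hl
    · rw [RowRep, hmem, Function.update_self, Function.update_of_ne (by omega),
        Function.update_self]
      refine ⟨by omega, ?_⟩
      rw [hw]
      push_cast
      simp
  · obtain ⟨e1, e2⟩ := hother l (by omega)
    rw [RowRep, e1, e2]
    exact h.rows_left l hl (by omega)

theorem shift_hoare {m n i : ℕ} {a : ℕ → ℕ → ℚ} {x : ℕ → ℚ} {M : ℕ → ℤ} {st : State} (hi : i < n)
    (hj : st.j < n) : Hoare (InnerInv m n a x M i st m) Code.shift Code.shift.size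
      (OuterInv m n M (i + 1) (st.next a x (delta m) m i)) := by
  refine Hoare.eval rfl ?_
  intro s h
  have hc := h.common
  have hxd : 0 < s.reg Reg.xd := by
    rw [h.xd]
    exact Int.natCast_pos.2 (x i).den_pos
  have hcd := hc.cd_pos
  have hxd' : (0 : ℚ) < s.reg Reg.xd := by exact_mod_cast hxd
  have hcd' : (0 : ℚ) < s.reg Reg.cd := by exact_mod_cast hcd
  have hsd' : (0 : ℚ) < s.reg Reg.sd := by exact_mod_cast h.sd_pos
  have hx : x i = s.reg Reg.xn / s.reg Reg.xd := by
    rw [h.xn, h.xd]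
    exact (Rat.num_div_den _).symm
  have hsum : st.c + x i = (s.reg Reg.cn * s.reg Reg.xd + s.reg Reg.xn * s.reg Reg.cd) /
      (s.reg Reg.cd * s.reg Reg.xd) := by
    rw [hc.c_eq, hx]
    field_simp
  have h1 : 1 < st.c + x i ↔ s.reg Reg.cd * s.reg Reg.xd <
      s.reg Reg.cn * s.reg Reg.xd + s.reg Reg.xn * s.reg Reg.cd := by
    rw [hsum, one_lt_div (mul_pos hcd' hxd')]
    exact_mod_cast Iff.rfl
  have hS : st.slope a x (delta m) m i = s.reg Reg.sn / s.reg Reg.sd := h.slope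
  have hpos : 0 < st.slope a x (delta m) m i ↔ 0 < s.reg Reg.sn := by
    rw [hS, div_pos_iff_of_pos_right hsd']
    exact_mod_cast Iff.rfl
  have hneg : 0 < -st.slope a x (delta m) m i ↔ s.reg Reg.sn < 0 := by
    rw [hS, neg_pos, div_neg_iff]
    simp only [hsd', not_lt.2 hsd'.le, and_true, and_false, false_or]
    exact_mod_cast Iff.rfl
  -- It remains to compare registers and memory with a new state that has these components.
  have key : ∀ (j' f' : ℕ) (v' : ℤ) (c' : ℚ), f' < n →
      (Code.shift.eval s).reg Reg.k = s.reg Reg.k - 1 →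
      (Code.shift.eval s).reg Reg.colI = s.reg Reg.colI + 2 →
      (Code.shift.eval s).reg Reg.colJ = ((2 + 2 * j' : ℕ) : ℤ) →
      (Code.shift.eval s).reg Reg.colF = ((2 + 2 * f' : ℕ) : ℤ) →
      (Code.shift.eval s).reg Reg.v = v' →
      (Code.shift.eval s).reg Reg.cd = s.reg Reg.cd * s.reg Reg.xd →
      (Code.shift.eval s).reg Reg.cn = c' * (s.reg Reg.cd * s.reg Reg.xd) →
      (Code.shift.eval s).mem = Function.update s.mem (yAddr m n f') v' →
      OuterInv m n M (i + 1)
        ⟨j', f', v', c', st.weight a x (delta m) i, Function.update st.y f' v'⟩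
        (Code.shift.eval s) := by
    intro j' f' v' c' hf' hk hI hJ hF hv hcd hc' hmem
    refine ⟨⟨hc.toConsts.eval (by decide), ?_, ?_, ?_, hJ, hF, hv, ?_, ?_, fun k hk => ?_,
      fun k hk => ?_⟩, fun r hr => ?_⟩
    · rw [Cmd.eval_reg (by decide), hc.d]
    · rw [hk, hc.k]
      push_cast
      ring
    · rw [hI, hc.colI]
      push_cast
      ring
    · rw [hcd]
      exact mul_pos hc.cd_pos hxd
    · rw [hcd, hc']
      push_cast
      rw [mul_div_cancel_right₀ _ (mul_pos hcd' hxd').ne']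
    · rw [hmem, Function.update_of_ne (by rw [yAddr]; rw [wAddr] at hk; omega)]
      exact hc.mem_input k hk
    · rw [hmem]
      change _ = Function.update st.y f' v' k
      by_cases e : k = f'
      · rw [e, Function.update_self, Function.update_self]
      · rw [Function.update_of_ne e, Function.update_of_ne (by rw [yAddr, yAddr]; omega)]
        exact hc.mem_y k hk
    · rw [RowRep, hmem, Function.update_of_ne (by rw [yAddr, wAddr]; omega),
        Function.update_of_ne (by rw [yAddr, wAddr]; omega)]
      exact h.rows_done r hr
  have hYI : (s.reg Reg.colI + s.reg Reg.yOff).toNat = yAddr m n i := by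
    rw [hc.colI, hc.yOff, yAddr]
    omega
  have hYJ : (s.reg Reg.colJ + s.reg Reg.yOff).toNat = yAddr m n st.j := by
    rw [hc.colJ, hc.yOff, yAddr]
    omega
  have hcx : (st.c + x i) * (s.reg Reg.cd * s.reg Reg.xd) =
      s.reg Reg.cn * s.reg Reg.xd + s.reg Reg.xn * s.reg Reg.cd := by
    rw [hsum, div_mul_cancel₀ _ (mul_pos hcd' hxd').ne']
  have h0 := hc.zero
  have hone := hc.one
  have htwo := hc.two
  have hI := hc.colI
  have hJ := hc.colJ
  simp only [Reg.zero, Reg.one, Reg.two, Reg.colI, Reg.colJ, Reg.xd, Reg.xn, Reg.cn, Reg.cd, Reg.sn,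
    Reg.yOff] at h0 hone htwo hI hJ h1 hpos hneg hYI hYJ hcx
  by_cases c1 : 1 < st.c + x i <;> by_cases c2 : 0 < st.criterion a x (delta m) m i
  all_goals
    simp only [State.next, c1, c2, if_true, if_false]
    simp only [State.criterion, c1, if_true, if_false, hpos, hneg] at c2
    rw [h1] at c1
    refine key _ _ _ _ (by assumption) ?_ ?_ ?_ ?_ ?_ ?_ ?_ ?_
  all_goals
    simp [Code.shift, Cmd.eval, Instr.effect, Instr.exec, Store.at, c1, c2, h0, hone, htwo, hYI,
      hYJ, sub_mul, hcx]
  all_goals simp [hI, hJ]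

theorem column_hoare {m n i : ℕ} {a : ℕ → ℕ → ℚ} {x : ℕ → ℚ} {M : ℕ → ℤ} {st : State}
    (hM : IsInput m n a x M) (ha : ∀ r k, 0 ≤ a r k) (hx : ∀ k, 0 ≤ x k) (hi : i < n)
    (hj : st.j < n) (hf : st.f < n) :
    Hoare (OuterInv m n M i st) Code.column (60 * m + 60)
      (OuterInv m n M (i + 1) (st.next a x (delta m) m i)) := by
  refine Hoare.mono ((readX_hoare hM hi).seq (Hoare.seq (Hoare.loop (InnerInv m n a x M i st)
    (fun r hr s hs => ?_) (fun s hs => ?_)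
    fun r hr => row_hoare hM ha hx hi hj hf hr) (shift_hoare hi hj))) (fun _ => id) ?_ fun _ => id
  · rw [hs.cnt]
    omega
  · rw [hs.cnt]
    omega
  · simp only [Code.readX, Code.row, Code.shift, Cmd.size, List.length]
    omega

/-- The states of the rounding procedure refer to columns of the matrix only. -/
theorem State.after_lt {a : ℕ → ℕ → ℚ} {x : ℕ → ℚ} {δ : ℚ} {m n i : ℕ} (hn : 1 ≤ n) (hi : i ≤ n) :
    (State.after a x δ m i).j < n ∧ (State.after a x δ m i).f < n := by
  induction i with
  | zero => exact ⟨hn, hn⟩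
  | succ i ih =>
    have := ih (by omega)
    simp only [State.after, State.next]
    constructor <;> split_ifs <;> omega

/-- The invariant of the loop that copies the output `z`, after `i` rounds. -/
structure CopyInv (m n : ℕ) (z : ℕ → ℤ) (i : ℕ) (s : Store) : Prop where
  one : s.reg Reg.one = 1
  two : s.reg Reg.two = 2
  k : s.reg Reg.k = (n : ℤ) - i
  pI : s.reg Reg.pI = i
  pJ : s.reg Reg.pJ = (yAddr m n i : ℤ)
  source : ∀ k < n, s.mem (yAddr m n k) = z k
  target : ∀ k < i, s.mem k = z k

theorem fixLast_hoare {m n : ℕ} {M : ℕ → ℤ} {st : State} :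
    Hoare (OuterInv m n M n st) Code.fixLast Code.fixLast.size (CopyInv m n st.output 0) := by
  refine Hoare.eval rfl ?_
  rintro s ⟨hc, -⟩
  have hcd' : (0 : ℚ) < s.reg Reg.cd := by exact_mod_cast hc.cd_pos
  have hcn : 0 < st.c ↔ 0 < s.reg Reg.cn := by
    rw [hc.c_eq, div_pos_iff_of_pos_right hcd']
    exact_mod_cast Iff.rfl
  have hYJ : (s.reg Reg.colJ + s.reg Reg.yOff).toNat = yAddr m n st.j := by
    rw [hc.colJ, hc.yOff, yAddr]
    omega
  have hmem : (Code.fixLast.eval s).mem = Function.update s.mem (yAddr m n st.j)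
      (if 0 < st.c then 1 else 0) := by
    simp only [Reg.colJ, Reg.yOff, Reg.cn] at hYJ hcn
    by_cases h : 0 < s.reg 15 <;>
      simp [Code.fixLast, Cmd.eval, Instr.effect, Instr.exec, Store.at, hcn, hYJ, h]
  have hn := hc.n_eq
  have h0 := hc.zero
  have h2 := hc.two
  have hY := hc.yOff
  simp only [Reg.n, Reg.zero, Reg.two, Reg.yOff] at hn h0 h2 hY
  refine ⟨?_, ?_, ?_, ?_, ?_, fun k hk => ?_, fun k hk => absurd hk k.not_lt_zero⟩
  · rw [Cmd.eval_reg (by decide), hc.one]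
  · rw [Cmd.eval_reg (by decide), hc.two]
  · by_cases h : 0 < s.reg 15 <;>
      simp [Code.fixLast, Cmd.eval, Instr.effect, Instr.exec, Store.at, h, hn, h0]
  · by_cases h : 0 < s.reg 15 <;>
      simp [Code.fixLast, Cmd.eval, Instr.effect, Instr.exec, Store.at, h]
  · by_cases h : 0 < s.reg 15 <;>
      simp [Code.fixLast, Cmd.eval, Instr.effect, Instr.exec, Store.at, h, hY, h2, yAddr, add_comm]
  · rw [hmem, State.output]
    by_cases e : k = st.j
    · rw [e, Function.update_self, Function.update_self]
    · rw [Function.update_of_ne e, Function.update_of_ne (by rw [yAddr, yAddr]; omega)]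
      exact hc.mem_y k hk

theorem copyLoop_hoare {m n : ℕ} {z : ℕ → ℤ} :
    Hoare (CopyInv m n z 0) Code.copyLoop (n * 7 + 2) (fun s => ∀ k < n, s.mem k = z k) := by
  refine Hoare.mono (Hoare.loop (T := 5) (CopyInv m n z) (fun i hi s hs => ?_) (fun s hs => ?_)
    fun i hi => Hoare.eval rfl fun s hs => ?_) (fun _ => id) le_rfl fun s hs => hs.target
  · rw [hs.k]
    omega
  · rw [hs.k]
    omega
  · have hk := hs.k
    have h1 := hs.one
    have h2 := hs.two
    have hI := hs.pI
    have hJ := hs.pJ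
    have hsrc := hs.source i hi
    simp only [Reg.one, Reg.two, Reg.k, Reg.pI, Reg.pJ] at h1 h2 hk hI hJ
    refine ⟨?_, ?_, ?_, ?_, ?_, fun k hk => ?_, fun k hk => ?_⟩
    all_goals
      simp [Cmd.eval, Instr.effect, Instr.exec, Store.at, h1, h2, hk, hI, hJ, hsrc]
    · ring
    · rw [yAddr, yAddr]
      push_cast
      ring
    · rw [Function.update_of_ne (by rw [yAddr]; omega)]
      exact hs.source k hk
    · rcases Nat.lt_succ_iff_lt_or_eq.1 hk with hk | rfl
      · rw [Function.update_of_ne (by omega)]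
        exact hs.target k hk
      · rw [Function.update_self]

/-- The program computes the output of the rounding procedure in time `O(m n)`. -/
theorem main_hoare {m n : ℕ} {a : ℕ → ℕ → ℚ} {x : ℕ → ℚ} {M : ℕ → ℤ} (hM : IsInput m n a x M)
    (ha : ∀ r k, 0 ≤ a r k) (hx : ∀ k, 0 ≤ x k) (hm : 1 ≤ m) (hn : 1 ≤ n) :
    Hoare (fun s => s = ⟨fun _ => 0, M⟩) Code.main (300 * (m * n))
      (fun s => ∀ k < n, s.mem k = (State.after a x (delta m) m n).output k) := by
  have hlt : ∀ {i}, i ≤ n → _ := fun hi => State.after_lt (a := a) (x := x) (δ := delta m)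
    (m := m) hn hi
  refine Hoare.mono ((setup_hoare hM).seq ((deltaLoop_hoare hm).seq ((initState_hoare hM).seq
    (Hoare.seq (Hoare.loop (fun i => OuterInv m n M i (State.after a x (delta m) m i))
      (fun i hi s hs => ?_) (fun s hs => ?_) fun i hi =>
        column_hoare hM ha hx hi (hlt hi.le).1 (hlt hi.le).2)
      (fixLast_hoare.seq copyLoop_hoare))))) (fun _ => id) ?_ fun _ => id
  · rw [hs.1.k]
    omega
  · rw [hs.1.k]
    omega
  · simp only [Code.setup, Code.initState, Code.fixLast, Cmd.size, List.length]
    nlinarith [Nat.mul_le_mul hm hn, Nat.mul_le_mul hm (le_refl n), Nat.mul_le_mul (le_refl m) hn]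

/-! ### The layout of the input -/

theorem getElem?_flatMap_of_length_eq {α β : Type*} {f : α → List β} {w : ℕ}
    (hf : ∀ b, (f b).length = w) {l : List α} {i j : ℕ} (hi : i < l.length) (hj : j < w) :
    (l.flatMap f)[j + i * w]? = (f l[i])[j]? := by
  induction l generalizing i with
  | nil => simp at hi
  | cons b l ih =>
    rw [List.flatMap_cons]
    cases i with
    | zero => rw [List.getElem?_append_left (by rw [hf]; omega)]; simp
    | succ i =>
      rw [List.getElem?_append_right (by rw [hf, Nat.succ_mul]; omega), hf, Nat.succ_mul,
        ← add_assoc, Nat.add_sub_cancel, ih (by simpa using hi)]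
      rfl

theorem length_flatMap_of_length_eq {α β : Type*} {f : α → List β} {w : ℕ}
    (hf : ∀ b, (f b).length = w) (l : List α) : (l.flatMap f).length = l.length * w := by
  simp [List.length_flatMap, hf]

variable {m n : ℕ}

/-- A matrix with index types `Fin m` and `Fin n`, continued by `0`. -/
def extendMatrix (A : Matrix (Fin m) (Fin n) ℚ) (r i : ℕ) : ℚ :=
  if h : r < m ∧ i < n then A ⟨r, h.1⟩ ⟨i, h.2⟩ else 0

/-- A vector with index type `Fin n`, continued by `0`. -/
def extendVector (x : Fin n → ℚ) (i : ℕ) : ℚ :=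
  if h : i < n then x ⟨i, h⟩ else 0

theorem extendMatrix_fin (A : Matrix (Fin m) (Fin n) ℚ) (r : Fin m) (i : Fin n) :
    extendMatrix A r i = A r i := by
  simp [extendMatrix]

theorem extendVector_fin (x : Fin n → ℚ) (i : Fin n) : extendVector x i = x i := by
  simp [extendVector]

theorem mulVec_eq_sum_range (A : Matrix (Fin m) (Fin n) ℚ) (y : ℕ → ℚ) (r : Fin m) :
    A.mulVec (fun i => y i) r = ∑ k ∈ range n, extendMatrix A r k * y k := by
  rw [← Fin.sum_univ_eq_sum_range (fun k => extendMatrix A r k * y k)]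
  simp [Matrix.mulVec, dotProduct, extendMatrix_fin]

theorem extendMatrix_mem {A : Matrix (Fin m) (Fin n) ℚ}
    (hA : ∀ r i, A r i ∈ Set.Icc (0 : ℚ) 1) (r i : ℕ) : extendMatrix A r i ∈ Set.Icc (0 : ℚ) 1 := by
  rw [extendMatrix]
  split_ifs
  · exact hA _ _
  · simp

theorem extendVector_mem {x : Fin n → ℚ} (hx : ∀ i, x i ∈ Set.Icc (0 : ℚ) 1) (i : ℕ) :
    extendVector x i ∈ Set.Icc (0 : ℚ) 1 := by
  rw [extendVector]
  split_ifs
  · exact hx _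
  · simp

theorem isInput_inputMemory (A : Matrix (Fin m) (Fin n) ℚ) (x : Fin n → ℚ) :
    IsInput m n (extendMatrix A) (extendVector x) (inputMemory A x) := by
  have hrat : ∀ q : ℚ, (ratWords q).length = 2 := fun _ => rfl
  have hvec : ∀ z : Fin n → ℚ,
      ((List.finRange n).flatMap fun i => ratWords (z i)).length = 2 * n := fun z => by
    rw [length_flatMap_of_length_eq fun i => hrat (z i), List.length_finRange, mul_comm]
  have hmat : ((List.finRange m).flatMap fun r => (List.finRange n).flatMap fun i =>
      ratWords (A r i)).length = m * (2 * n) := by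
    rw [length_flatMap_of_length_eq fun r => hvec (A r), List.length_finRange]
  have hget : ∀ (z : Fin n → ℚ) (i : ℕ) (hi : i < n) (j : ℕ), j < 2 →
      ((List.finRange n).flatMap fun i => ratWords (z i))[j + i * 2]? =
        (ratWords (z ⟨i, hi⟩))[j]? := fun z i hi j hj => by
    rw [getElem?_flatMap_of_length_eq (fun i => hrat (z i)) (by simpa using hi) hj]
    simp
  have hx : ∀ (i : ℕ) (hi : i < n) (j : ℕ), j < 2 →
      inputMemory A x (2 + 2 * i + m * (2 * n) + j) = (ratWords (x ⟨i, hi⟩)).getD j 0 := by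
    intro i hi j hj
    rw [inputMemory, inputWords, List.getD_eq_getElem?_getD, List.getD_eq_getElem?_getD,
      ← hget x i hi j hj, List.getElem?_append_right, List.length_append, hmat]
    · congr 2
      simp only [List.length_cons, List.length_nil]
      omega
    · rw [List.length_append, hmat]
      simp only [List.length_cons, List.length_nil]
      omega
  have ha : ∀ (r : ℕ) (hr : r < m) (i : ℕ) (hi : i < n) (j : ℕ), j < 2 →
      inputMemory A x (2 + 2 * i + r * (2 * n) + j) =
        (ratWords (A ⟨r, hr⟩ ⟨i, hi⟩)).getD j 0 := by
    intro r hr i hi j hj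
    have hrow : r * (2 * n) + 2 * n ≤ m * (2 * n) := by
      rw [← Nat.succ_mul]
      exact Nat.mul_le_mul_right _ hr
    have hr' := getElem?_flatMap_of_length_eq (l := List.finRange m) (i := r) (j := j + i * 2)
      (fun r => hvec (A r)) (by simpa using hr) (by omega)
    simp only [List.getElem_finRange, Fin.cast_mk] at hr'
    rw [inputMemory, inputWords, List.getD_eq_getElem?_getD, List.getD_eq_getElem?_getD,
      ← hget _ i hi j hj, List.append_assoc, List.getElem?_append_right, List.getElem?_append_left]
    · rw [← hr']
      congr 2
      simp only [List.length_cons, List.length_nil]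
      omega
    · rw [hmat]
      simp only [List.length_cons, List.length_nil]
      omega
    · simp only [List.length_cons, List.length_nil]
      omega
  refine ⟨rfl, rfl, fun r hr i hi => ?_, fun r hr i hi => ?_, fun i hi => ?_, fun i hi => ?_,
    fun k hk => ?_⟩
  · simpa [extendMatrix, hr, hi, ratWords] using ha r hr i hi 0 (by omega)
  · simpa [extendMatrix, hr, hi, ratWords] using ha r hr i hi 1 (by omega)
  · simpa [extendVector, hi, ratWords] using hx i hi 0 (by omega)
  · simpa [extendVector, hi, ratWords] using hx i hi 1 (by omega)
  · rw [inputMemory, List.getD_eq_default]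
    rw [inputWords, List.length_append, List.length_append, hmat, hvec]
    exact hk

end PipageRounding

theorem theorem2 :
    ∃ (P : RAM.Program) (C₁ C₂ : ℝ),
      ∀ (m n : ℕ), 1 ≤ m → 1 ≤ n →
      ∀ (A : Matrix (Fin m) (Fin n) ℚ) (x : Fin n → ℚ),
        (∀ r i, A r i ∈ Set.Icc (0 : ℚ) 1) →
        (∀ i, x i ∈ Set.Icc (0 : ℚ) 1) →
        (∃ k : ℤ, ∑ i, x i = (k : ℚ)) →
        ∃ (M : ℕ → ℤ) (y : Fin n → ℤ),
          -- the running time; `y` is written to the cells `0, …, n - 1`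
          P.HaltsWithin (RAM.inputMemory A x)
            (C₁ * ((m : ℝ) * (n : ℝ) * Real.log (max (n : ℝ) 2))) M ∧
          (∀ i : Fin n, M (i : ℕ) = y i) ∧
          -- the rounding
          (∀ i, y i = 0 ∨ y i = 1) ∧
          ∑ i, (y i : ℚ) = ∑ i, x i ∧
          ∀ r, ((A.mulVec (fun i => (y i : ℚ)) r : ℚ) : ℝ) ≤
            C₂ * (max 1 ((A.mulVec x r : ℚ) : ℝ) *
              (Real.log (max (m : ℝ) 3) / Real.log (Real.log (max (m : ℝ) 3)))) := by
  refine ⟨PipageRounding.Code.main.compile 0, 600, 4, ?_⟩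
  intro m n hm hn A x hA hx hsum
  set a := PipageRounding.extendMatrix A with ha_def
  set z := PipageRounding.extendVector x with hz_def
  have ha0 : ∀ r i, 0 ≤ a r i := fun r i => (PipageRounding.extendMatrix_mem hA r i).1
  have ha1 : ∀ r i, a r i ≤ 1 := fun r i => (PipageRounding.extendMatrix_mem hA r i).2
  have hz0 : ∀ i, 0 ≤ z i := fun i => (PipageRounding.extendVector_mem hx i).1
  have hz1 : ∀ i, z i ≤ 1 := fun i => (PipageRounding.extendVector_mem hx i).2
  have hsum_eq : ∑ i ∈ Finset.range n, z i = ∑ i, x i := by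
    rw [← Fin.sum_univ_eq_sum_range]
    exact Finset.sum_congr rfl fun i _ => PipageRounding.extendVector_fin x i
  have hsum' : ∃ k : ℤ, ∑ i ∈ Finset.range n, z i = k := by rwa [hsum_eq]
  have hδ : (0 : ℚ) ≤ PipageRounding.delta m := Nat.cast_nonneg _
  have hinv := PipageRounding.Invariant.after (m := m) hδ ha0 hz0 hz1 hn
  have htime : ((300 * (m * n) : ℕ) : ℝ) ≤
      600 * ((m : ℝ) * (n : ℝ) * Real.log (max (n : ℝ) 2)) := by
    have hlog : 1 / 2 ≤ Real.log (max (n : ℝ) 2) :=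
      (le_trans (by norm_num) Real.log_two_gt_d9.le).trans
        (Real.log_le_log (by norm_num) (le_max_right _ _))
    have := mul_le_mul_of_nonneg_left hlog (by positivity : (0 : ℝ) ≤ (m : ℝ) * n)
    push_cast
    linarith
  obtain ⟨s, hs, hhalt⟩ := (PipageRounding.main_hoare
    (PipageRounding.isInput_inputMemory A x) ha0 hz0 hm hn).haltsWithin rfl htime
  set st := PipageRounding.State.after a z (PipageRounding.delta m) m n with hst
  refine ⟨s.mem, fun i => st.output i, hhalt, fun i => hs i i.2,
    fun i => hinv.output_zero_or_one i, ?_, fun r => ?_⟩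
  · rw [Fin.sum_univ_eq_sum_range (fun i => (st.output i : ℚ)), hinv.sum_output hsum', hsum_eq]
  · have hAy := PipageRounding.mulVec_eq_sum_range A (fun k => (st.output k : ℚ)) r
    have hAx := PipageRounding.mulVec_eq_sum_range A z r
    simp only [hz_def, PipageRounding.extendVector_fin] at hAx
    rw [← ha_def] at hAy hAx
    rw [← hz_def] at hAx
    have hprod := hinv.prod_output_le hδ ha0 hz0 hsum' r.2
    have hprod' : ∏ k ∈ Finset.range n, (1 + (PipageRounding.delta m : ℝ) * (a r k : ℝ) *
          st.output k) ≤
        m * ∏ k ∈ Finset.range n, (1 + (PipageRounding.delta m : ℝ) * (a r k : ℝ) * (z k : ℝ)) := by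
      exact_mod_cast hprod
    rw [hAy, hAx]
    push_cast
    refine PipageRounding.le_of_mul_log_le hm (PipageRounding.sum_mul_log_le (Nat.cast_nonneg _)
      (fun k => ?_) (fun k => ?_) (fun k => hinv.output_zero_or_one k) (fun k => ?_) hm hprod')
    · exact_mod_cast ha0 r k
    · exact_mod_cast ha1 r k
    · exact_mod_cast hz0 k
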